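/- All graphs are finite and simple. The class of \emph{2-trees} is defined recursively: $K_3$ is a 2-tree, and any graph obtained from a 2-tree by adding a new vertex $x$ and making it adjacent to exactly the two endpoints of some existing edge $uv$ is a 2-tree. A \emph{partial 2-tree} is a graph isomorphic to a subgraph of a 2-tree. A graph has \emph{treewidth at most two} if it has a tree decomposition all of whose bags have at most three vertices. A \emph{straight-line drawing} $\Gamma$ of a graph $G$ maps the vertices of $G$ to distinct points of $\mathbb{R}^2$ and each edge to the straight-line segment between its endpoints, such that no edge passes through a vertex other than its endpoints; edges may cross. The \emph{outer face} of $\Gamma$ is the unbounded connected component of the complement in $\mathbb{R}^2$ of the union of all vertices and edges of $\Gamma$. A vertex is \emph{on the outer face} if it lies on the boundary of the outer face, and an edge is \emph{incident to the outer face} if some non-degenerate subsegment of it is contained in the boundary of the outer face. An \emph{outside-obstacle representation} (OOR) of $G$ is a straight-line drawing of $G$ such that two distinct vertices $u,v$ are adjacent if and only if the segment $\overline{uv}$ is disjoint from the outer face; that is, every non-edge meets the outer face. An OOR is \emph{reducible} if every edge is incident to the outer face. \textbf{Theorem.} Every 2-tree admits a reducible OOR with all vertices on the outer face. Moreover, every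 partial 2-tree, and every graph of treewidth at most two, admits a reducible OOR with all vertices on the outer face. -/

import Mathlib

namespace OutsideObstacle

universe u

/-- The Euclidean plane. -/
abbrev Plane : Type := EuclideanSpace ℝ (Fin 2)

/-! ### 2-trees, partial 2-trees and treewidth -/

/-- The class of 2-trees: a triangle is a 2-tree, and a graph is a 2-tree if it arises from a
2-tree by stacking a new vertex `x` on an edge `ab`, that is, if `x` is adjacent to exactly the two
endpoints of the edge `ab` and removing `x` leaves a 2-tree. -/
inductive IsTwoTree : {V : Type u} → SimpleGraph V → Prop
  | triangle {V : Type u} (G : SimpleGraph V)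
      (e : G ≃g (⊤ : SimpleGraph (Fin 3))) : IsTwoTree G
  | stack {V : Type u} (G : SimpleGraph V) (x a b : V)
      (hab : G.Adj a b) (hx : G.neighborSet x = {a, b})
      (hG : IsTwoTree (G.induce {x}ᶜ)) : IsTwoTree G

/-- A partial 2-tree is a graph that is (isomorphic to) a subgraph of a 2-tree. -/
def IsPartialTwoTree {V : Type u} (G : SimpleGraph V) : Prop :=
  ∃ (W : Type u) (T : SimpleGraph W), IsTwoTree T ∧ G.IsContained T

/-- A tree decomposition of `G`, indexed by the nodes of a tree on `I`. -/
structure TreeDecomposition {V : Type u} (G : SimpleGraph V) (I : Type) where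
  /-- The underlying tree. -/
  tree : SimpleGraph I
  isTree : tree.IsTree
  /-- The bags. -/
  bag : I → Finset V
  vertex_mem_bag : ∀ v : V, ∃ i, v ∈ bag i
  edge_mem_bag : ∀ v w : V, G.Adj v w → ∃ i, v ∈ bag i ∧ w ∈ bag i
  bags_connected : ∀ v : V, (tree.induce {i | v ∈ bag i}).Connected

/-- `G` has treewidth at most `k`: it has a tree decomposition (over a finite tree) of width at
most `k`, the width being the maximum size of a bag minus one. -/
def TreewidthAtMost {V : Type u} (G : SimpleGraph V) (k : ℕ) : Prop :=
  ∃ (I : Type) (_ : Finite I) (D : TreeDecomposition G I), ∀ i, (D.bag i).card ≤ k + 1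

/-! ### Straight-line drawings and outside-obstacle representations -/

variable {V : Type u}

/-- The vertices of `G` placed at `p` form a straight-line drawing: distinct vertices are placed at
distinct points, and no edge passes through a vertex other than its endpoints (in particular, no
two edges overlap). Edges may cross. -/
structure IsStraightLineDrawing (G : SimpleGraph V) (p : V → Plane) : Prop where
  injective : Function.Injective p
  eq_or_eq_of_mem_edge : ∀ v w x : V, G.Adj v w → p x ∈ segment ℝ (p v) (p w) → x = v ∨ x = w

/-- The point set covered by the drawing: all vertices and all edges. -/
def drawingSet (G : SimpleGraph V) (p : V → Plane) : Set Plane :=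
  Set.range p ∪ ⋃ (v : V) (w : V) (_ : G.Adj v w), segment ℝ (p v) (p w)

/-- The outer face of the drawing: the unbounded connected component of the complement of the
drawing. -/
def outerFace (G : SimpleGraph V) (p : V → Plane) : Set Plane :=
  {x | x ∉ drawingSet G p ∧
    ¬ Bornology.IsBounded (connectedComponentIn (drawingSet G p)ᶜ x)}

/-- A vertex is incident to the outer face if it lies on the boundary of the outer face. -/
def VertexOnOuterFace (G : SimpleGraph V) (p : V → Plane) (v : V) : Prop :=
  p v ∈ frontier (outerFace G p)

/-- The edge `vw` is incident to the outer face if a non-degenerate piece of it belongs to the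
boundary of the outer face. (Touching the outer face in isolated points, such as endpoints or
crossings, is not enough.) -/
def EdgeOnOuterFace (G : SimpleGraph V) (p : V → Plane) (v w : V) : Prop :=
  ∃ a b : Plane, a ≠ b ∧ segment ℝ a b ⊆ segment ℝ (p v) (p w) ∧
    segment ℝ a b ⊆ frontier (outerFace G p)

/-- An outside-obstacle representation of `G`: a straight-line drawing such that `G` is the
visibility graph of its vertices with respect to one obstacle, the outer face. Thus edges avoid
the outer face and non-edges meet it. -/
structure IsOOR (G : SimpleGraph V) (p : V → Plane) : Prop
    extends IsStraightLineDrawing G p where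
  adj_iff : ∀ v w : V, v ≠ w →
    (G.Adj v w ↔ Disjoint (segment ℝ (p v) (p w)) (outerFace G p))

/-- A reducible outside-obstacle representation: every edge is incident to the outer face. -/
structure IsReducibleOOR (G : SimpleGraph V) (p : V → Plane) : Prop extends IsOOR G p where
  edge_on_outerFace : ∀ v w : V, G.Adj v w → EdgeOnOuterFace G p v w

/-- `G` admits a reducible outside-obstacle representation with all vertices on the outer face. -/
def AdmitsReducibleOORWithVerticesOnOuterFace (G : SimpleGraph V) : Prop :=
  ∃ p : V → Plane, IsReducibleOOR G p ∧ ∀ v, VertexOnOuterFace G p v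

end OutsideObstacle

namespace OutsideObstacle

open Filter Topology Set

universe u

/-! ### Escaping to infinity -/

/-! The drawing grows by stacking vertices on oriented edges. The invariant `IsGood` asks that each
edge can be prolonged a little beyond its head through the outer face, that some interior point of
it, on no other edge, is accessible from one side `f > 0`, and that edges sharing its head are
prolonged into `f ≥ 0`. To stack on `u → v`, with `e = v - u`, put `x = v + τ e - σ n` with `σ` much
smaller than `τ`, and `τ` small: just past `v`, slightly on the side `f < 0`. Both new edges point
to `x` and hug the prolonged old edge.

Everything old survives small parameters. Membership in the outer face is witnessed by a compact
connected set (`Escapes`) that misses `uv`, hence also the new edges. Accessibility of a boundary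
point is witnessed by a half-open segment (`Ray`), which can only be endangered when it starts on
`uv`; there the side condition or the direction of the ray saves it. Near `x` only the thin sector
between the new edges may be cut off (`Frame.eventually_escapes_near`). Old vertices other than `u`,
`v` are seen from `x` outside this sector, so non-edges at `x` meet the outer face. This gives
`IsGood.exists_stack`.

Subgraphs come for free: deleting an edge opens it at its accessible interior point
(`IsGood.admits`). It remains to place a graph injectively so that adjacent vertices are joined, by
following the stacking order or by adding the bags of a tree decomposition one at a time. -/

lemma tendsto_add_smul_nhdsGT (z d : Plane) :
    Tendsto (fun t : ℝ => z + t • d) (𝓝[>] 0) (𝓝 z) := by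
  have : ContinuousAt (fun t : ℝ => z + t • d) 0 := by fun_prop
  have := this.tendsto
  simp only [zero_smul, add_zero] at this
  exact this.mono_left nhdsWithin_le_nhds

lemma tendsto_mul_nhdsGT (a : ℝ) : Tendsto (fun t : ℝ => t * a) (𝓝[>] 0) (𝓝 0) := by
  have : ContinuousAt (fun t : ℝ => t * a) 0 := by fun_prop
  have := this.tendsto
  rw [zero_mul] at this
  exact this.mono_left nhdsWithin_le_nhds

/-- The point `z` can be joined, within the complement of `D`, to a point outside the disk of
radius two around the origin. -/
def Escapes (D : Set Plane) (z : Plane) : Prop :=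
  ∃ K, IsCompact K ∧ IsPreconnected K ∧ K ⊆ Dᶜ ∧ z ∈ K ∧ ∃ y ∈ K, 2 ≤ ‖y‖

lemma Escapes.notMem {D : Set Plane} {z : Plane} (h : Escapes D z) : z ∉ D := by
  obtain ⟨K, _, _, hD, hz, _⟩ := h
  exact hD hz

lemma Escapes.anti {D E : Set Plane} {z : Plane} (h : Escapes D z) (hED : E ⊆ D) :
    Escapes E z := by
  obtain ⟨K, hc, hp, hD, h⟩ := h
  exact ⟨K, hc, hp, hD.trans (compl_subset_compl.2 hED), h⟩

lemma isCompact_segment (y z : Plane) : IsCompact (segment ℝ y z) := by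
  rw [segment_eq_image_lineMap]
  exact isCompact_Icc.image AffineMap.lineMap_continuous

lemma Escapes.of_segment {D : Set Plane} {y z : Plane} (h : Escapes D y)
    (hs : segment ℝ z y ⊆ Dᶜ) : Escapes D z := by
  obtain ⟨K, hc, hp, hD, hy, w, hw, hw2⟩ := h
  refine ⟨segment ℝ z y ∪ K, (isCompact_segment z y).union hc,
    IsPreconnected.union y (right_mem_segment ℝ z y) hy (convex_segment z y).isPreconnected hp,
    union_subset hs hD, .inl (left_mem_segment ℝ z y), w, .inr hw, hw2⟩

lemma Escapes.of_convex {D C : Set Plane} {y z : Plane} (h : Escapes D y) (hC : Convex ℝ C)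
    (hCD : C ⊆ Dᶜ) (hy : y ∈ C) (hz : z ∈ C) : Escapes D z :=
  h.of_segment ((hC.segment_subset hz hy).trans hCD)

lemma escapes_of_forall_add_smul {D : Set Plane} {z d : Plane} (hd : d ≠ 0)
    (h : ∀ t : ℝ, 0 ≤ t → z + t • d ∉ D) : Escapes D z := by
  have hd' : 0 < ‖d‖ := norm_pos_iff.2 hd
  -- This length makes `‖T • d‖ = 2 + ‖z‖`, so the end of the segment has norm at least two.
  set T : ℝ := (2 + ‖z‖) / ‖d‖ with hT
  have hT0 : 0 ≤ T := by positivity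
  have hsub : segment ℝ z (z + T • d) ⊆ Dᶜ := by
    rw [segment_eq_image']
    rintro _ ⟨s, hs, rfl⟩
    have := h (s * T) (mul_nonneg hs.1 hT0)
    simpa [smul_smul] using this
  refine ⟨segment ℝ z (z + T • d), isCompact_segment _ _, (convex_segment _ _).isPreconnected,
    hsub, left_mem_segment _ _ _, z + T • d, right_mem_segment _ _ _, ?_⟩
  have h1 : ‖T • d‖ = 2 + ‖z‖ := by
    rw [norm_smul, Real.norm_of_nonneg hT0, hT, div_mul_cancel₀ _ hd'.ne']
  have h2 : ‖T • d‖ ≤ ‖z + T • d‖ + ‖z‖ := by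
    simpa using norm_sub_le (z + T • d) z
  linarith

/-- The half-open segment from `w` (excluded) to `w + d` consists of escaping points. -/
def Ray (D : Set Plane) (w d : Plane) : Prop :=
  ∀ t : ℝ, 0 < t → t ≤ 1 → Escapes D (w + t • d)

lemma Ray.anti {D E : Set Plane} {w d : Plane} (h : Ray D w d) (hED : E ⊆ D) : Ray E w d :=
  fun t h0 h1 => (h t h0 h1).anti hED

/-- All points slide along the segment to its far end, so only that end has to escape. -/
lemma ray_of_escapes {D : Set Plane} {w d : Plane} (h : Escapes D (w + d))
    (hD : ∀ t : ℝ, 0 < t → t ≤ 1 → w + t • d ∉ D) : Ray D w d := by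
  intro t h0 h1
  refine h.of_segment ?_
  rw [segment_eq_image']
  rintro _ ⟨s, hs, rfl⟩
  have := hD (t + s * (1 - t)) (by nlinarith [hs.1, hs.2]) (by nlinarith [hs.1, hs.2])
  have h2 : w + t • d + s • (w + d - (w + t • d)) = w + (t + s * (1 - t)) • d := by module
  rw [← h2] at this
  exact this

lemma Ray.mem_closure {D S : Set Plane} {w d : Plane} (h : Ray D w d)
    (hS : ∀ z, Escapes D z → z ∈ S) : w ∈ closure S := by
  refine mem_closure_of_tendsto (tendsto_add_smul_nhdsGT w d) ?_
  filter_upwards [Ioc_mem_nhdsGT (zero_lt_one' ℝ)] with t ht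
  exact hS _ (h t ht.1 ht.2)

/-! ### Coordinates along an edge -/

/-- Coordinate functionals `g`, `f` for the basis `e`, `n` of the plane. -/
structure Frame (e n : Plane) (g f : Plane →L[ℝ] ℝ) : Prop where
  g_e : g e = 1
  f_e : f e = 0
  g_n : g n = 0
  f_n : f n = 1
  repr : ∀ z, z = g z • e + f z • n

/-- The two new edges when a vertex is stacked on the edge from `u` to `u + e`. -/
def newEdges (u e n : Plane) (τ σ : ℝ) : Set Plane :=
  segment ℝ u (u + ((1 + τ) • e - σ • n)) ∪ segment ℝ (u + e) (u + ((1 + τ) • e - σ • n))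

section Coordinates

variable {u e n : Plane} {g f : Plane →L[ℝ] ℝ} {τ σ : ℝ}

lemma Frame.eq_of_mem_segment_left (F : Frame e n g f) {z : Plane}
    (hz : z ∈ segment ℝ u (u + ((1 + τ) • e - σ • n))) :
    ∃ s : ℝ, 0 ≤ s ∧ s ≤ 1 ∧ g (z - u) = s * (1 + τ) ∧ f (z - u) = -(s * σ) := by
  rw [segment_eq_image'] at hz
  obtain ⟨s, hs, rfl⟩ := hz
  refine ⟨s, hs.1, hs.2, ?_, ?_⟩ <;> simp [F.g_e, F.f_e, F.g_n, F.f_n]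

lemma Frame.eq_of_mem_segment_right (F : Frame e n g f) {z : Plane}
    (hz : z ∈ segment ℝ (u + e) (u + ((1 + τ) • e - σ • n))) :
    ∃ s : ℝ, 0 ≤ s ∧ s ≤ 1 ∧ g (z - u) = 1 + s * τ ∧ f (z - u) = -(s * σ) := by
  rw [segment_eq_image'] at hz
  obtain ⟨s, hs, rfl⟩ := hz
  refine ⟨s, hs.1, hs.2, ?_, ?_⟩ <;> simp [F.g_e, F.f_e, F.g_n, F.f_n]
  ring

/-- The new edges lie in a thin box below the prolonged edge, above a line of slope `-σ` through
`u`, and touch the line `f = 0` only at `u` and `u + e`. -/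
lemma Frame.coord_of_mem_newEdges (F : Frame e n g f) (hτ : 0 < τ) (hσ : 0 < σ) {z : Plane}
    (hz : z ∈ newEdges u e n τ σ) :
    0 ≤ g (z - u) ∧ g (z - u) ≤ 1 + τ ∧ -σ ≤ f (z - u) ∧ f (z - u) ≤ 0 ∧
      -(σ * g (z - u)) ≤ f (z - u) ∧ (f (z - u) = 0 → g (z - u) = 0 ∨ g (z - u) = 1) := by
  rcases hz with hz | hz
  · obtain ⟨s, h0, h1, hg, hf⟩ := F.eq_of_mem_segment_left hz
    rw [hg, hf]
    refine ⟨by positivity, by nlinarith, by nlinarith, by nlinarith,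
      by nlinarith [mul_nonneg (mul_nonneg h0 hσ.le) hτ.le], fun h => .inl ?_⟩
    have : s = 0 := by
      rcases mul_eq_zero.1 (neg_eq_zero.1 h) with h | h
      · exact h
      · exact absurd h hσ.ne'
    simp [this]
  · obtain ⟨s, h0, h1, hg, hf⟩ := F.eq_of_mem_segment_right hz
    rw [hg, hf]
    refine ⟨by positivity, by nlinarith, by nlinarith, by nlinarith,
      by nlinarith [mul_nonneg (mul_nonneg h0 hσ.le) hτ.le], fun h => .inr ?_⟩
    have : s = 0 := by
      rcases mul_eq_zero.1 (neg_eq_zero.1 h) with h | h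
      · exact h
      · exact absurd h hσ.ne'
    simp [this]

lemma Frame.mem_segment_iff (F : Frame e n g f) {c : ℝ} (hc : 0 < c) {z : Plane} :
    z ∈ segment ℝ u (u + c • e) ↔ 0 ≤ g (z - u) ∧ g (z - u) ≤ c ∧ f (z - u) = 0 := by
  rw [segment_eq_image']
  constructor
  · rintro ⟨s, hs, rfl⟩
    simp only [add_sub_cancel_left, map_smul, F.g_e, F.f_e, smul_eq_mul, mul_zero, mul_one,
      and_true]
    exact ⟨mul_nonneg hs.1 hc.le, by nlinarith [hs.2]⟩
  · rintro ⟨h0, h1, h2⟩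
    refine ⟨g (z - u) / c, ⟨by positivity, by rwa [div_le_one hc]⟩, ?_⟩
    have h3 := F.repr (z - u)
    rw [h2, zero_smul, add_zero] at h3
    rw [add_sub_cancel_left]
    dsimp only
    rw [smul_smul, div_mul_cancel₀ _ hc.ne', ← h3]
    abel

lemma Frame.mem_segment_iff' (F : Frame e n g f) {z : Plane} :
    z ∈ segment ℝ u (u + e) ↔ 0 ≤ g (z - u) ∧ g (z - u) ≤ 1 ∧ f (z - u) = 0 := by
  simpa using F.mem_segment_iff (u := u) one_pos (z := z)

/-- Projecting along `n` moves a point of the new edges by at most `σ ‖n‖` onto the prolonged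
segment, which has positive distance from `K`. -/
lemma Frame.eventually_disjoint_newEdges (F : Frame e n g f) (hτ : 0 < τ) {K : Set Plane}
    (hK : IsCompact K) (hd : Disjoint K (segment ℝ u (u + (1 + τ) • e))) :
    ∀ᶠ σ in 𝓝[>] (0 : ℝ), Disjoint K (newEdges u e n τ σ) := by
  obtain ⟨δ, hδ, h⟩ := hd.exists_thickenings hK (isCompact_segment _ _).isClosed
  have hn := tendsto_mul_nhdsGT (‖n‖)
  filter_upwards [self_mem_nhdsWithin, hn.eventually_lt_const hδ] with σ hσ hlt
  refine Set.disjoint_left.2 fun z hzK hz => ?_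
  obtain ⟨h0, h1, h2, h3, -, -⟩ := F.coord_of_mem_newEdges hτ hσ hz
  refine Set.disjoint_left.1 h (Metric.self_subset_thickening hδ K hzK)
    (Metric.mem_thickening_iff.2 ⟨u + g (z - u) • e, ?_, ?_⟩)
  · rw [F.mem_segment_iff (by linarith)]
    simp [F.g_e, F.f_e] at h0 h1 ⊢
    exact ⟨h0, h1⟩
  · have h4 : z - (u + g (z - u) • e) = f (z - u) • n := by
      have := F.repr (z - u)
      rw [← sub_sub]
      nth_rewrite 1 [this]
      abel
    rw [dist_eq_norm, h4, norm_smul, Real.norm_eq_abs, abs_of_nonpos h3]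
    exact lt_of_le_of_lt (mul_le_mul_of_nonneg_right (by linarith) (norm_nonneg n)) hlt

lemma eventually_disjoint_segment {K : Set Plane}
    (hK : IsCompact K) (hd : Disjoint K (segment ℝ u (u + e))) :
    ∀ᶠ τ in 𝓝[>] (0 : ℝ), Disjoint K (segment ℝ u (u + (1 + τ) • e)) := by
  obtain ⟨δ, hδ, h⟩ := hd.exists_thickenings hK (isCompact_segment _ _).isClosed
  have hn := tendsto_mul_nhdsGT (‖e‖)
  filter_upwards [self_mem_nhdsWithin, hn.eventually_lt_const hδ] with τ hτ hlt
  have hτ : 0 < τ := hτ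
  refine Set.disjoint_left.2 fun z hzK hz => ?_
  rw [segment_eq_image'] at hz
  obtain ⟨s, hs, rfl⟩ := hz
  refine Set.disjoint_left.1 h (Metric.self_subset_thickening hδ K hzK)
    (Metric.mem_thickening_iff.2 ⟨u + s • e, ?_, ?_⟩)
  · rw [segment_eq_image']
    exact ⟨s, hs, by simp⟩
  · have h4 : u + s • (u + (1 + τ) • e - u) - (u + s • e) = (s * τ) • e := by module
    rw [dist_eq_norm, h4, norm_smul, Real.norm_eq_abs, abs_of_nonneg (mul_nonneg hs.1 hτ.le)]
    refine lt_of_le_of_lt (mul_le_mul_of_nonneg_right ?_ (norm_nonneg e)) hlt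
    nlinarith [hs.2]

/-- First `τ` and then, depending on `τ`, `σ` are small positive numbers. -/
abbrev smallParams : Filter (ℝ × ℝ) := (𝓝[>] (0 : ℝ)).curry (𝓝[>] 0)

lemma eventually_pos_smallParams : ∀ᶠ p in smallParams, 0 < p.1 ∧ 0 < p.2 := by
  rw [Filter.eventually_curry_iff]
  filter_upwards [self_mem_nhdsWithin] with τ hτ
  filter_upwards [self_mem_nhdsWithin] with σ hσ using ⟨hτ, hσ⟩

lemma Frame.eventually_disjoint (F : Frame e n g f) {K : Set Plane}
    (hK : IsCompact K) (hd : Disjoint K (segment ℝ u (u + e))) :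
    ∀ᶠ p in smallParams, Disjoint K (newEdges u e n p.1 p.2) := by
  rw [Filter.eventually_curry_iff]
  filter_upwards [self_mem_nhdsWithin, eventually_disjoint_segment hK hd] with τ hτ h
  exact F.eventually_disjoint_newEdges hτ hK h

lemma Escapes.union {D E K : Set Plane} {z : Plane} (hc : IsCompact K) (hp : IsPreconnected K)
    (hD : K ⊆ Dᶜ) (hz : z ∈ K) (hy : ∃ y ∈ K, 2 ≤ ‖y‖) (hE : Disjoint K E) :
    Escapes (D ∪ E) z := by
  refine ⟨K, hc, hp, ?_, hz, hy⟩
  rw [compl_union]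
  exact subset_inter hD hE.subset_compl_right

lemma Frame.eventually_escapes (F : Frame e n g f) {D : Set Plane} (huv : segment ℝ u (u + e) ⊆ D)
    {z : Plane} (hz : Escapes D z) :
    ∀ᶠ p in smallParams, Escapes (D ∪ newEdges u e n p.1 p.2) z := by
  obtain ⟨K, hc, hp, hD, hz, hy⟩ := hz
  have hd : Disjoint K (segment ℝ u (u + e)) :=
    (disjoint_compl_left.mono_right huv).mono_left hD
  filter_upwards [F.eventually_disjoint hc hd] with p h
  exact Escapes.union hc hp hD hz hy h

lemma Frame.eventually_ray (F : Frame e n g f) {D : Set Plane} (huv : segment ℝ u (u + e) ⊆ D)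
    {w d : Plane} (hr : Ray D w d)
    (hE : ∀ᶠ p in smallParams, ∀ t : ℝ, 0 < t → t ≤ 1 → w + t • d ∉ newEdges u e n p.1 p.2) :
    ∀ᶠ p in smallParams, Ray (D ∪ newEdges u e n p.1 p.2) w d := by
  have h1 : Escapes D (w + d) := by simpa using hr 1 one_pos le_rfl
  filter_upwards [hE, F.eventually_escapes huv h1] with p hp he
  refine ray_of_escapes he fun t h0 h1 => ?_
  rintro (h | h)
  · exact (hr t h0 h1).notMem h
  · exact hp t h0 h1 h

/-- With its starting point off `uv`, the closed ray is itself a compact set missing `uv`. -/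
lemma Frame.eventually_ray_of_notMem (F : Frame e n g f) {D : Set Plane}
    (huv : segment ℝ u (u + e) ⊆ D) {w d : Plane} (hr : Ray D w d)
    (hw : w ∉ segment ℝ u (u + e)) :
    ∀ᶠ p in smallParams, Ray (D ∪ newEdges u e n p.1 p.2) w d := by
  refine F.eventually_ray huv hr ?_
  have hd : Disjoint (segment ℝ w (w + d)) (segment ℝ u (u + e)) := by
    refine Set.disjoint_left.2 fun z hz hz' => ?_
    rw [segment_eq_image'] at hz
    obtain ⟨s, hs, rfl⟩ := hz
    rw [add_sub_cancel_left] at hz'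
    rcases hs.1.eq_or_lt with rfl | h
    · simp only [zero_smul, add_zero] at hz'
      exact hw hz'
    · exact (hr s h hs.2).notMem (huv hz')
  filter_upwards [F.eventually_disjoint (isCompact_segment _ _) hd] with p h t h0 h1 h2
  refine Set.disjoint_left.1 h ?_ h2
  rw [segment_eq_image']
  exact ⟨t, ⟨h0.le, h1⟩, by simp⟩

lemma Frame.eventually_ray_of_pos (F : Frame e n g f) {D : Set Plane}
    (huv : segment ℝ u (u + e) ⊆ D) {w d : Plane} (hr : Ray D w d)
    (hw : w ∈ segment ℝ u (u + e)) (hd : 0 < f d) :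
    ∀ᶠ p in smallParams, Ray (D ∪ newEdges u e n p.1 p.2) w d := by
  refine F.eventually_ray huv hr ?_
  filter_upwards [eventually_pos_smallParams] with p ⟨hτ, hσ⟩ t h0 h1 h2
  obtain ⟨-, -, -, h3, -, -⟩ := F.coord_of_mem_newEdges hτ hσ h2
  obtain ⟨-, -, hw⟩ := F.mem_segment_iff'.1 hw
  have : f (w + t • d - u) = f (w - u) + t * f d := by simp; ring
  rw [this, hw] at h3
  nlinarith [mul_pos h0 hd]

lemma Frame.eventually_ray_of_eq_zero (F : Frame e n g f) {D : Set Plane}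
    (huv : segment ℝ u (u + e) ⊆ D) {d : Plane} (hr : Ray D (u + e) d) (hd : f d = 0) :
    ∀ᶠ p in smallParams, Ray (D ∪ newEdges u e n p.1 p.2) (u + e) d := by
  refine F.eventually_ray huv hr ?_
  filter_upwards [eventually_pos_smallParams] with p ⟨hτ, hσ⟩ t h0 h1 h2
  obtain ⟨h3, -, -, -, -, h4⟩ := F.coord_of_mem_newEdges hτ hσ h2
  have h5 : g (u + e + t • d - u) = 1 + t * g d := by simp [F.g_e]; ring
  have h6 : f (u + e + t • d - u) = 0 := by simp [F.f_e, hd]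
  refine (hr t h0 h1).notMem (huv (F.mem_segment_iff'.2 ⟨h3, ?_, h6⟩))
  rcases h4 h6 with h | h <;> rw [h]
  exact zero_le_one

/-- At the tail every ray survives: the new edge leaves `u` almost along `e`, a direction that the
old edge already forbids. -/
lemma Frame.eventually_ray_left (F : Frame e n g f) {D : Set Plane}
    (huv : segment ℝ u (u + e) ⊆ D) {d : Plane} (hr : Ray D u d) :
    ∀ᶠ p in smallParams, Ray (D ∪ newEdges u e n p.1 p.2) u d := by
  rcases lt_or_ge 0 (f d) with hd | hd
  · exact F.eventually_ray_of_pos huv hr (left_mem_segment _ _ _) hd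
  refine F.eventually_ray huv hr ?_
  have hg : g d ≤ 0 ∨ f d < 0 := by
    by_contra! hcon
    have hf : f d = 0 := le_antisymm hd hcon.2
    obtain ⟨t, h0, h1, h2⟩ : ∃ t : ℝ, 0 < t ∧ t ≤ 1 ∧ t * g d ≤ 1 := by
      -- A parameter at most one for which the point of a ray directed along `e` still lies on `uv`.
      refine ⟨1 / (1 + g d), by have := hcon.1; positivity, ?_, ?_⟩
      · rw [div_le_one (by linarith)]; linarith
      · rw [div_mul_eq_mul_div, div_le_one (by linarith)]; linarith
    refine (hr t h0 h1).notMem (huv (F.mem_segment_iff'.2 ?_))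
    simp only [add_sub_cancel_left, map_smul, smul_eq_mul, hf, mul_zero, and_true]
    exact ⟨mul_nonneg h0.le hcon.1.le, h2⟩
  have hlim := tendsto_mul_nhdsGT (g d)
  rw [Filter.eventually_curry_iff]
  filter_upwards [self_mem_nhdsWithin] with τ hτ
  rcases hd.eq_or_lt with hd | hd
  · filter_upwards [self_mem_nhdsWithin] with σ hσ t h0 h1 h2
    obtain ⟨h3, -, -, -, -, h4⟩ := F.coord_of_mem_newEdges hτ hσ h2
    have h5 : g (u + t • d - u) = t * g d := by simp
    have h6 : f (u + t • d - u) = 0 := by simp [hd]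
    have hg : g d ≤ 0 := hg.resolve_right (by simp [hd])
    have h7 : t * g d ≤ 0 := mul_nonpos_of_nonneg_of_nonpos h0.le hg
    rcases h4 h6 with h | h
    · refine (hr t h0 h1).notMem (huv (F.mem_segment_iff'.2 ⟨h3, ?_, h6⟩))
      rw [h]; exact zero_le_one
    · linarith
  -- Once `σ * g d < -f d`, the ray runs strictly below the line of slope `-σ` that bounds the new
  -- edges from below.
  · filter_upwards [self_mem_nhdsWithin, hlim.eventually_lt_const (neg_pos.2 hd)] with
      σ hσ hlt t h0 h1 h2
    obtain ⟨-, -, -, -, h4, -⟩ := F.coord_of_mem_newEdges hτ hσ h2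
    have h5 : g (u + t • d - u) = t * g d := by simp
    have h6 : f (u + t • d - u) = t * f d := by simp
    rw [h5, h6] at h4
    nlinarith [mul_lt_mul_of_pos_left hlt h0]

/-- Near the new vertex everything outside the sector between the two new edges escapes. -/
lemma Frame.eventually_escapes_near (F : Frame e n g f) {D : Set Plane} (hD : IsClosed D)
    (huv : segment ℝ u (u + e) ⊆ D) {c : ℝ} (hc : 0 < c) (hr : Ray D (u + e) (c • e)) :
    ∀ᶠ p in smallParams, ∃ r > 0,
      Metric.ball (u + ((1 + p.1) • e - p.2 • n)) r ⊆ Dᶜ ∧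
      ∀ z ∈ Metric.ball (u + ((1 + p.1) • e - p.2 • n)) r,
        (0 < p.2 * g (z - (u + ((1 + p.1) • e - p.2 • n))) +
          p.1 * f (z - (u + ((1 + p.1) • e - p.2 • n))) ∨
        0 < -(p.2 * g (z - (u + ((1 + p.1) • e - p.2 • n))) +
          (1 + p.1) * f (z - (u + ((1 + p.1) • e - p.2 • n))))) →
        Escapes (D ∪ newEdges u e n p.1 p.2) z := by
  have hr' : ∀ t : ℝ, 0 < t → t ≤ c → Escapes D (u + (1 + t) • e) := by
    intro t h0 h1
    have := hr (t / c) (by positivity) (by rwa [div_le_one hc])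
    rw [smul_smul, div_mul_cancel₀ _ hc.ne'] at this
    rwa [add_smul, one_smul, ← add_assoc]
  obtain ⟨K, hKc, hKp, hKD, hK1, hK2⟩ := hr' c hc le_rfl
  have hKd : Disjoint K (segment ℝ u (u + e)) :=
    (disjoint_compl_left.mono_right huv).mono_left hKD
  rw [Filter.eventually_curry_iff]
  filter_upwards [Ioo_mem_nhdsGT hc, eventually_disjoint_segment hKc hKd] with τ ⟨hτ, hτc⟩ hKτ
  obtain ⟨R, hR, hball⟩ := Metric.isOpen_iff.1 hD.isOpen_compl (u + (1 + τ) • e)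
    (hr' τ hτ hτc.le).notMem
  have he : 0 < ‖e‖ := by
    rw [norm_pos_iff]
    rintro rfl
    simpa using F.g_e
  -- The point `q` will lie on the old prolongation, past the position of `x`, and inside the ball
  -- of radius `R`; it escapes along `L` and then `K`.
  obtain ⟨s, hs0, hsR, hsc⟩ : ∃ s : ℝ, 0 < s ∧ s * ‖e‖ < R ∧ τ + s ≤ c := by
    refine ⟨min (c - τ) (R / (2 * ‖e‖)), lt_min (by linarith) (by positivity), ?_, ?_⟩
    · have : min (c - τ) (R / (2 * ‖e‖)) * ‖e‖ ≤ R / (2 * ‖e‖) * ‖e‖ :=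
        mul_le_mul_of_nonneg_right (min_le_right _ _) he.le
      have h2 : R / (2 * ‖e‖) * ‖e‖ = R / 2 := by field_simp
      linarith
    · linarith [min_le_left (c - τ) (R / (2 * ‖e‖))]
  set q : Plane := u + (1 + (τ + s)) • e with hq
  set L : Set Plane := segment ℝ q (u + (1 + c) • e) with hL
  have hLmem : ∀ z ∈ L, ∃ t : ℝ, τ < t ∧ t ≤ c ∧ z = u + (1 + t) • e := by
    intro z hz
    rw [hL, segment_eq_image'] at hz
    obtain ⟨a, ha, rfl⟩ := hz
    refine ⟨τ + s + a * (c - (τ + s)), by nlinarith [ha.1, ha.2], by nlinarith [ha.1, ha.2], ?_⟩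
    simp only [hq]
    module
  have hLD : L ⊆ Dᶜ := by
    intro z hz
    obtain ⟨t, h0, h1, rfl⟩ := hLmem z hz
    exact (hr' t (hτ.trans h0) h1).notMem
  have hLd : Disjoint L (segment ℝ u (u + (1 + τ) • e)) := by
    refine Set.disjoint_left.2 fun z hz hz' => ?_
    obtain ⟨t, h0, h1, rfl⟩ := hLmem z hz
    have := ((F.mem_segment_iff (by linarith)).1 hz').2.1
    simp [F.g_e] at this
    linarith
  have hn := tendsto_mul_nhdsGT (‖n‖)
  filter_upwards [self_mem_nhdsWithin, hn.eventually_lt_const hR,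
    F.eventually_disjoint_newEdges hτ hKc hKτ,
    F.eventually_disjoint_newEdges hτ (isCompact_segment _ _) hLd] with σ hσ hσR hK' hL'
  have hσ : 0 < σ := hσ
  set x : Plane := u + ((1 + τ) • e - σ • n) with hx
  set E := newEdges u e n τ σ with hE
  have hxB : x ∈ Metric.ball (u + (1 + τ) • e) R := by
    have : x - (u + (1 + τ) • e) = -(σ • n) := by rw [hx]; abel
    rw [Metric.mem_ball, dist_eq_norm, this, norm_neg, norm_smul, Real.norm_of_nonneg hσ.le]
    exact hσR
  have hqB : q ∈ Metric.ball (u + (1 + τ) • e) R := by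
    have : q - (u + (1 + τ) • e) = s • e := by rw [hq]; module
    rw [Metric.mem_ball, dist_eq_norm, this, norm_smul, Real.norm_of_nonneg hs0.le]
    exact hsR
  have hqE : Escapes (D ∪ E) q := by
    refine (Escapes.union hKc hKp hKD hK1 hK2 hK').of_segment ?_
    rw [compl_union]
    exact subset_inter hLD hL'.subset_compl_right
  set f₁ : Plane →L[ℝ] ℝ := σ • g + τ • f with hf₁
  set f₂ : Plane →L[ℝ] ℝ := -(σ • g + (1 + τ) • f) with hf₂
  have hgx : g (x - u) = 1 + τ := by simp [hx, F.g_e, F.g_n]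
  have hfx : f (x - u) = -σ := by simp [hx, F.f_e, F.f_n]
  have hgz : ∀ z, g (z - x) = g (z - u) - (1 + τ) := by
    intro z; rw [← hgx, ← map_sub]; congr 1; abel
  have hfz : ∀ z, f (z - x) = f (z - u) + σ := by
    intro z; rw [← neg_neg σ, ← hfx, ← sub_eq_add_neg, ← map_sub]; congr 1; abel
  -- The zero lines of `f₁` and `f₂` through `x` carry the edges from `u + e` and from `u`. Each
  -- positive half of the ball is therefore a convex set free of edges.
  have hEneg : ∀ z ∈ E, f₁ (z - x) ≤ 0 ∧ f₂ (z - x) ≤ 0 := by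
    intro z hz
    simp only [hf₁, hf₂, add_apply, neg_apply,
      smul_apply, smul_eq_mul, hgz, hfz]
    rcases hz with hz | hz
    · obtain ⟨s, h0, h1, hg, hf⟩ := F.eq_of_mem_segment_left hz
      rw [hg, hf]
      constructor <;> nlinarith [mul_nonneg (sub_nonneg.2 h1) hσ.le]
    · obtain ⟨s, h0, h1, hg, hf⟩ := F.eq_of_mem_segment_right hz
      rw [hg, hf]
      constructor <;> nlinarith [mul_nonneg (sub_nonneg.2 h1) hσ.le]
  have hconv : ∀ φ : Plane →L[ℝ] ℝ,
      Convex ℝ (Metric.ball (u + (1 + τ) • e) R ∩ {z | 0 < φ (z - x)}) := by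
    intro φ
    refine (convex_ball _ _).inter ?_
    simp only [map_sub, sub_pos]
    exact convex_halfSpace_gt φ.toLinearMap.isLinear _
  have hsub : ∀ φ : Plane →L[ℝ] ℝ, (∀ z ∈ E, φ (z - x) ≤ 0) →
      Metric.ball (u + (1 + τ) • e) R ∩ {z | 0 < φ (z - x)} ⊆ (D ∪ E)ᶜ := by
    rintro φ hφ z ⟨hz, hz'⟩ (h | h)
    · exact hball hz h
    · exact absurd (hφ z h) (not_le.2 hz')
  have h₁ : ∀ z ∈ Metric.ball (u + (1 + τ) • e) R, 0 < f₁ (z - x) → Escapes (D ∪ E) z := by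
    intro z hz hz'
    refine hqE.of_convex (hconv f₁) (hsub f₁ fun z hz => (hEneg z hz).1) ⟨hqB, ?_⟩ ⟨hz, hz'⟩
    simp only [hf₁, mem_ofPred_eq, add_apply, smul_apply,
      smul_eq_mul, hgz, hfz]
    have : g (q - u) = 1 + (τ + s) := by simp [hq, F.g_e]
    have h' : f (q - u) = 0 := by simp [hq, F.f_e]
    rw [this, h']
    nlinarith [mul_pos hσ hs0, mul_pos hσ hτ]
  -- The half-disk `f₁ > 0` contains `q`. The half-disk `f₂ > 0` is reached through a common point
  -- `y` beyond `x`, in the direction `(x - u) + (x - (u + e))`.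
  obtain ⟨y, hyB, hy1, hy2⟩ : ∃ y ∈ Metric.ball (u + (1 + τ) • e) R,
      0 < f₁ (y - x) ∧ 0 < f₂ (y - x) := by
    have hlim := tendsto_add_smul_nhdsGT x ((2 * (1 + τ) - 1) • e - (2 * σ) • n)
    obtain ⟨t, ht, ht0⟩ := ((hlim.eventually (Metric.isOpen_ball.mem_nhds hxB)).and
      self_mem_nhdsWithin).exists
    have ht0 : 0 < t := ht0
    refine ⟨_, ht, ?_, ?_⟩
    all_goals
      simp only [hf₁, hf₂, add_apply, neg_apply,
        smul_apply, smul_eq_mul, add_sub_cancel_left, map_smul, map_sub,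
        F.g_e, F.f_e, F.g_n, F.f_n]
      nlinarith [mul_pos ht0 hσ]
  have h₂ : ∀ z ∈ Metric.ball (u + (1 + τ) • e) R, 0 < f₂ (z - x) → Escapes (D ∪ E) z :=
    fun z hz hz' => (h₁ y hyB hy1).of_convex (hconv f₂)
      (hsub f₂ fun z hz => (hEneg z hz).2) ⟨hyB, hy2⟩ ⟨hz, hz'⟩
  obtain ⟨r, hr, hrB⟩ := Metric.isOpen_iff.1 Metric.isOpen_ball x hxB
  refine ⟨r, hr, hrB.trans hball, fun z hz => ?_⟩
  rintro (h | h)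
  · exact h₁ z (hrB hz) h
  · exact h₂ z (hrB hz) h

end Coordinates

/-! ### Geometric configurations of oriented edges -/

/-- The endpoints of a set of oriented edges. -/
def verts (A : Set (Plane × Plane)) : Set Plane :=
  {w | ∃ a ∈ A, w = a.1 ∨ w = a.2}

/-- The points covered by a set of oriented edges. -/
def cover (A : Set (Plane × Plane)) : Set Plane :=
  ⋃ a ∈ A, segment ℝ a.1 a.2

/-- The edge `a` can be prolonged beyond its head, its open segment is accessible from one side
(where `f` is positive), and the other edges with the same head are prolonged to that side. -/
def IsGoodEdge (A : Set (Plane × Plane)) (a : Plane × Plane) : Prop :=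
  ∃ n g f, Frame (a.2 - a.1) n g f ∧
    (∃ c : ℝ, 0 < c ∧ Ray (cover A) a.2 (c • (a.2 - a.1))) ∧
    (∀ w, (w, a.2) ∈ A → 0 ≤ f (a.2 - w)) ∧
    ∃ m ∈ openSegment ℝ a.1 a.2, (∀ b ∈ A, b ≠ a → m ∉ segment ℝ b.1 b.2) ∧
      ∃ d, 0 < f d ∧ Ray (cover A) m d

/-- The invariant of the recursive construction. -/
structure IsGood (A : Set (Plane × Plane)) : Prop where
  finite : A.Finite
  nonempty : A.Nonempty
  norm_lt : ∀ w ∈ verts A, ‖w‖ < 2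
  eq_or_eq : ∀ a ∈ A, ∀ w ∈ verts A, w ∈ segment ℝ a.1 a.2 → w = a.1 ∨ w = a.2
  ray : ∀ w ∈ verts A, ∃ d, Ray (cover A) w d
  nonedge : ∀ v ∈ verts A, ∀ w ∈ verts A, v ≠ w → (v, w) ∉ A → (w, v) ∉ A →
    ∃ z ∈ segment ℝ v w, Escapes (cover A) z
  edge : ∀ a ∈ A, IsGoodEdge A a

lemma segment_subset_cover {A : Set (Plane × Plane)} {a : Plane × Plane} (ha : a ∈ A) :
    segment ℝ a.1 a.2 ⊆ cover A :=
  subset_biUnion_of_mem (u := fun a : Plane × Plane => segment ℝ a.1 a.2) ha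

lemma verts_subset_cover (A : Set (Plane × Plane)) : verts A ⊆ cover A := by
  rintro w ⟨a, ha, rfl | rfl⟩
  · exact segment_subset_cover ha (left_mem_segment _ _ _)
  · exact segment_subset_cover ha (right_mem_segment _ _ _)

lemma fst_mem_verts {A : Set (Plane × Plane)} {a : Plane × Plane} (ha : a ∈ A) : a.1 ∈ verts A :=
  ⟨a, ha, .inl rfl⟩

lemma snd_mem_verts {A : Set (Plane × Plane)} {a : Plane × Plane} (ha : a ∈ A) : a.2 ∈ verts A :=
  ⟨a, ha, .inr rfl⟩

lemma finite_verts {A : Set (Plane × Plane)} (hA : A.Finite) : (verts A).Finite := by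
  refine ((hA.image Prod.fst).union (hA.image Prod.snd)).subset ?_
  rintro w ⟨a, ha, rfl | rfl⟩
  · exact .inl ⟨a, ha, rfl⟩
  · exact .inr ⟨a, ha, rfl⟩

lemma isClosed_cover {A : Set (Plane × Plane)} (hA : A.Finite) : IsClosed (cover A) :=
  hA.isClosed_biUnion fun _ _ => (isCompact_segment _ _).isClosed

lemma cover_insert (a : Plane × Plane) (A : Set (Plane × Plane)) :
    cover (insert a A) = segment ℝ a.1 a.2 ∪ cover A :=
  biUnion_insert a A _

lemma mem_verts_insert {a : Plane × Plane} {A : Set (Plane × Plane)} {w : Plane} :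
    w ∈ verts (insert a A) ↔ (w = a.1 ∨ w = a.2) ∨ w ∈ verts A := by
  simp [verts, or_and_right, exists_or]

lemma exists_smul_ball {x d : Plane} {r : ℝ} (hr : 0 < r) :
    ∃ c : ℝ, 0 < c ∧ ∀ t : ℝ, 0 ≤ t → t ≤ c → x + t • d ∈ Metric.ball x r := by
  refine ⟨r / (2 * (1 + ‖d‖)), by positivity, fun t h0 h1 => ?_⟩
  have h2 : 0 ≤ ‖d‖ := norm_nonneg d
  rw [Metric.mem_ball, dist_eq_norm, add_sub_cancel_left, norm_smul, Real.norm_of_nonneg h0]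
  have h3 : t * (2 * (1 + ‖d‖)) ≤ r := by rwa [le_div_iff₀ (by positivity)] at h1
  nlinarith

/-! ### The invariant for the two edges at a new vertex -/

section NewEdge

variable {A : Set (Plane × Plane)} {w w' x : Plane}

/-- Stated for one new edge `w → x` so as to serve both by symmetry. The positive sides of `φ` and
`φ'` face away from the sector, and each edge is prolonged into the free side of the other. -/
lemma isGoodEdge_insert {n : Plane} {g φ φ' : Plane →L[ℝ] ℝ} (F : Frame (x - w) n g φ)
    (hpos : 0 < φ (x - w')) (hpos' : 0 < φ' (x - w)) {r : ℝ} (hr : 0 < r)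
    (hball : Metric.ball x r ⊆ (cover A)ᶜ)
    (hnear : ∀ z ∈ Metric.ball x r, 0 < φ (z - x) ∨ 0 < φ' (z - x) →
      Escapes (cover (insert (w, x) (insert (w', x) A))) z) :
    IsGoodEdge (insert (w, x) (insert (w', x) A)) (w, x) := by
  have hxA : x ∉ cover A := hball (Metric.mem_ball_self hr)
  refine ⟨n, g, φ, F, ?_, ?_, ?_⟩
  · obtain ⟨c, hc, h⟩ := exists_smul_ball (x := x) (d := x - w) hr
    refine ⟨c, hc, fun t h0 h1 => ?_⟩
    dsimp only
    rw [smul_smul]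
    refine hnear _ (h _ (by positivity) (by nlinarith)) (.inr ?_)
    rw [add_sub_cancel_left, map_smul, smul_eq_mul]
    positivity
  · rintro v (h | h | h)
    · obtain rfl : v = w := (Prod.ext_iff.1 h).1
      exact F.f_e.ge
    · obtain rfl : v = w' := (Prod.ext_iff.1 h).1
      exact hpos.le
    · exact absurd (verts_subset_cover A (snd_mem_verts h)) hxA
  · obtain ⟨c, hc, h⟩ := exists_smul_ball (x := x) (d := w - x) hr
    -- The accessible interior point is taken so close to `x` that no old edge reaches it.
    obtain ⟨t, ht0, ht1, htc⟩ : ∃ t : ℝ, 0 < t ∧ t < 1 ∧ t ≤ c :=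
      ⟨min c (1 / 2), by positivity, by linarith [min_le_right c (1 / 2)], min_le_left _ _⟩
    have hm := h t ht0.le htc
    have hφm : φ (x + t • (w - x) - x) = 0 := by
      rw [add_sub_cancel_left, ← neg_sub x w, map_smul, map_neg, F.f_e]; simp
    refine ⟨x + t • (w - x), ?_, ?_, ?_⟩
    · rw [openSegment_symm, openSegment_eq_image']
      exact ⟨t, ⟨ht0, ht1⟩, rfl⟩
    · rintro b (rfl | rfl | hb) hne hmb
      · exact hne rfl
      · rw [segment_symm, segment_eq_image'] at hmb
        obtain ⟨s, hs, h1⟩ := hmb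
        dsimp only at h1
        rw [← h1, add_sub_cancel_left, ← neg_sub x w', map_smul, map_neg, smul_eq_mul] at hφm
        have hs0 : s = 0 := by
          rcases mul_eq_zero.1 hφm with h | h
          · exact h
          · linarith
        rw [hs0, zero_smul, add_right_inj, eq_comm, smul_eq_zero] at h1
        rcases h1 with h1 | h1
        · exact ht0.ne' h1
        · have := F.g_e
          rw [← neg_sub, h1] at this
          simp at this
      · exact hball hm (segment_subset_cover hb hmb)
    · obtain ⟨r', hr', hrB⟩ := Metric.isOpen_iff.1 Metric.isOpen_ball _ hm
      obtain ⟨c', hc', h'⟩ := exists_smul_ball (x := x + t • (w - x)) (d := n) hr'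
      refine ⟨c' • n, by simp [F.f_n, hc'], fun s h0 h1 => ?_⟩
      rw [smul_smul]
      refine hnear _ (hrB (h' _ (by positivity) (by nlinarith))) (.inl ?_)
      rw [add_sub_right_comm, map_add, hφm, map_smul, F.f_n]
      simp only [smul_eq_mul, mul_one, zero_add]
      positivity

end NewEdge

/-! ### Stacking a vertex on an edge of a good configuration -/

section Stack

variable {A : Set (Plane × Plane)} {u e n : Plane} {g f : Plane →L[ℝ] ℝ}

/-- The position of the vertex stacked on the edge from `u` to `u + e`. -/
def stackPoint (u e n : Plane) (p : ℝ × ℝ) : Plane := u + ((1 + p.1) • e - p.2 • n)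

/-- The configuration with an additional vertex stacked on the edge from `u` to `u + e`. -/
def stacked (A : Set (Plane × Plane)) (u e n : Plane) (p : ℝ × ℝ) : Set (Plane × Plane) :=
  insert (u, stackPoint u e n p) (insert (u + e, stackPoint u e n p) A)

lemma cover_stacked (p : ℝ × ℝ) :
    cover (stacked A u e n p) = cover A ∪ newEdges u e n p.1 p.2 := by
  rw [stacked, cover_insert, cover_insert, newEdges, ← union_assoc, union_comm]
  rfl

lemma eventually_stackPoint_mem {U : Set Plane} (hU : IsOpen U) (h : u + e ∈ U) :
    ∀ᶠ p in smallParams, stackPoint u e n p ∈ U := by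
  rw [Filter.eventually_curry_iff]
  filter_upwards [(tendsto_add_smul_nhdsGT (u + e) e).eventually (hU.mem_nhds h)] with τ hτ
  filter_upwards [(tendsto_add_smul_nhdsGT (u + e + τ • e) (-n)).eventually (hU.mem_nhds hτ)]
    with σ hσ
  have h1 : stackPoint u e n (τ, σ) = u + e + τ • e + σ • -n := by
    simp only [stackPoint]
    module
  rw [h1]
  exact hσ

/-- As the parameters shrink, the sector at `x` leaves only the segment `uv` for points to hide in.
The two expressions equal `τ * f (w - u) - σ * (1 - g (w - u))` and `-(σ * g (w - u) + (1 + τ) * f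
(w - u))`, so the sign of `f (w - u)` decides, and on the line `f = 0` the position beyond either
end. -/
lemma Frame.eventually_sides (F : Frame e n g f) {w : Plane} (hw : w ∉ segment ℝ u (u + e)) :
    ∀ᶠ p in smallParams,
      0 < p.2 * g (w - stackPoint u e n p) + p.1 * f (w - stackPoint u e n p) ∨
      0 < -(p.2 * g (w - stackPoint u e n p) + (1 + p.1) * f (w - stackPoint u e n p)) := by
  rw [Filter.eventually_curry_iff]
  filter_upwards [self_mem_nhdsWithin] with τ hτ
  have hτ : 0 < τ := hτ
  have hg : ∀ σ, g (w - stackPoint u e n (τ, σ)) = g (w - u) - (1 + τ) := by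
    intro σ
    simp [stackPoint, F.g_e, F.g_n]
    ring
  have hf : ∀ σ, f (w - stackPoint u e n (τ, σ)) = f (w - u) + σ := by
    intro σ
    simp [stackPoint, F.f_e, F.f_n]
    ring
  simp only [hg, hf]
  rcases lt_trichotomy (f (w - u)) 0 with h | h | h
  · filter_upwards [self_mem_nhdsWithin,
      (tendsto_mul_nhdsGT (g (w - u))).eventually_lt_const (neg_pos.2 h)] with σ hσ hlt
    right
    nlinarith
  · rw [F.mem_segment_iff', not_and_or, not_and_or] at hw
    filter_upwards [self_mem_nhdsWithin] with σ hσ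
    have hσ : 0 < σ := hσ
    rw [h]
    rcases hw with hw | hw | hw
    · right
      nlinarith
    · left
      nlinarith
    · exact absurd h hw
  · filter_upwards [self_mem_nhdsWithin,
      (tendsto_mul_nhdsGT (1 - g (w - u))).eventually_lt_const (mul_pos hτ h)] with σ hσ hlt
    left
    nlinarith

lemma Frame.stack_right (F : Frame e n g f) {p : ℝ × ℝ} (h1 : 0 < p.1) :
    Frame (stackPoint u e n p - (u + e)) (p.1⁻¹ • n) (p.1⁻¹ • g) (p.2 • g + p.1 • f) := by
  have h : stackPoint u e n p - (u + e) = p.1 • e - p.2 • n := by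
    simp only [stackPoint]; module
  rw [h]
  refine ⟨?_, ?_, ?_, ?_, fun z => ?_⟩
  · simp [F.g_e, F.g_n, h1.ne']
  · simp [F.g_e, F.g_n, F.f_e, F.f_n]; ring
  · simp [F.g_n]
  · simp [F.g_n, F.f_n, h1.ne']
  · nth_rewrite 1 [F.repr z]
    simp only [add_apply, smul_apply, smul_eq_mul,
      smul_sub, smul_smul]
    match_scalars <;> field_simp
    ring

lemma Frame.stack_left (F : Frame e n g f) {p : ℝ × ℝ} (h1 : 0 < p.1) :
    Frame (stackPoint u e n p - u) (-(1 + p.1)⁻¹ • n) ((1 + p.1)⁻¹ • g)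
      (-(p.2 • g + (1 + p.1) • f)) := by
  have h : stackPoint u e n p - u = (1 + p.1) • e - p.2 • n := by
    simp only [stackPoint]; module
  have h2 : 1 + p.1 ≠ 0 := by positivity
  rw [h]
  refine ⟨?_, ?_, ?_, ?_, fun z => ?_⟩
  · simp [F.g_e, F.g_n, h2]
  · simp [F.g_e, F.g_n, F.f_e, F.f_n]; ring
  · simp [F.g_n]
  · simp [F.g_n, F.f_n, h2]
  · nth_rewrite 1 [F.repr z]
    simp only [add_apply, smul_apply, smul_eq_mul,
      neg_apply, smul_sub, smul_smul, add_smul]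
    match_scalars <;> field_simp
    ring

lemma IsGood.eventually_ray (h : IsGood A) (hA : (u, u + e) ∈ A) (F : Frame e n g f)
    {c : ℝ} (hr : Ray (cover A) (u + e) (c • e)) {w : Plane} (hw : w ∈ verts A) :
    ∀ᶠ p in smallParams, ∃ d, Ray (cover (stacked A u e n p)) w d := by
  have huv : segment ℝ u (u + e) ⊆ cover A := segment_subset_cover hA
  simp only [cover_stacked]
  obtain ⟨d, hd⟩ := h.ray w hw
  by_cases hws : w ∈ segment ℝ u (u + e)
  · rcases h.eq_or_eq _ hA w hw hws with rfl | rfl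
    · exact (F.eventually_ray_left huv hd).mono fun p hp => ⟨d, hp⟩
    -- At the head the given ray may be crossed by the edge from `u`, so it is replaced by the
    -- prolongation of `uv`.
    · exact (F.eventually_ray_of_eq_zero huv hr (by simp [F.f_e])).mono fun p hp => ⟨_, hp⟩
  · exact (F.eventually_ray_of_notMem huv hd hws).mono fun p hp => ⟨d, hp⟩

lemma IsGood.eventually_isGoodEdge (h : IsGood A) (hA : (u, u + e) ∈ A) (F : Frame e n g f)
    {c : ℝ} (hc : 0 < c) (hr : Ray (cover A) (u + e) (c • e))
    (hside : ∀ w, (w, u + e) ∈ A → 0 ≤ f (u + e - w)) {m : Plane}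
    (hm : m ∈ openSegment ℝ u (u + e))
    (hmA : ∀ b ∈ A, b ≠ (u, u + e) → m ∉ segment ℝ b.1 b.2)
    {d : Plane} (hd : 0 < f d) (hmd : Ray (cover A) m d) {a : Plane × Plane} (ha : a ∈ A) :
    ∀ᶠ p in smallParams, IsGoodEdge (stacked A u e n p) a := by
  have huv : segment ℝ u (u + e) ⊆ cover A := segment_subset_cover hA
  have hx : ∀ᶠ p in smallParams, stackPoint u e n p ∉ cover A := by
    obtain h1 := F.eventually_escapes_near (isClosed_cover h.finite) huv hc hr
    filter_upwards [h1] with p ⟨r, hr, hb, _⟩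
    exact hb (Metric.mem_ball_self hr)
  have key : ∀ (n' : Plane) (g' f' : Plane →L[ℝ] ℝ) (c' : ℝ) (m' d' : Plane),
      Frame (a.2 - a.1) n' g' f' → 0 < c' →
      (∀ᶠ p in smallParams, Ray (cover (stacked A u e n p)) a.2 (c' • (a.2 - a.1))) →
      (∀ w, (w, a.2) ∈ A → 0 ≤ f' (a.2 - w)) →
      m' ∈ openSegment ℝ a.1 a.2 → (∀ b ∈ A, b ≠ a → m' ∉ segment ℝ b.1 b.2) →
      (∀ᶠ p in smallParams, m' ∉ newEdges u e n p.1 p.2) → 0 < f' d' →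
      (∀ᶠ p in smallParams, Ray (cover (stacked A u e n p)) m' d') →
      ∀ᶠ p in smallParams, IsGoodEdge (stacked A u e n p) a := by
    intro n' g' f' c' m' d' F' hc' hr' hs' hm' hmA' hmn' hd' hmd'
    filter_upwards [hx, hr', hmn', hmd'] with p hxp hrp hmp hmdp
    refine ⟨n', g', f', F', ⟨c', hc', hrp⟩, ?_, m', hm', ?_, d', hd', hmdp⟩
    · rintro w (h1 | h1 | h1)
      · have := (Prod.ext_iff.1 h1).2
        dsimp only at this
        exact absurd (this ▸ verts_subset_cover A (snd_mem_verts ha)) hxp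
      · have := (Prod.ext_iff.1 h1).2
        dsimp only at this
        exact absurd (this ▸ verts_subset_cover A (snd_mem_verts ha)) hxp
      · exact hs' w h1
    · rintro b (rfl | rfl | hb) hne hmb
      · exact hmp (.inl hmb)
      · exact hmp (.inr hmb)
      · exact hmA' b hb hne hmb
  obtain ⟨n', g', f', F', ⟨c', hc', hr'⟩, hs', m', hm', hmA', d', hd', hmd'⟩ := h.edge a ha
  have hray : ∀ᶠ p in smallParams, Ray (cover (stacked A u e n p)) a.2 (c' • (a.2 - a.1)) := by
    simp only [cover_stacked]
    by_cases hws : a.2 ∈ segment ℝ u (u + e)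
    · rcases h.eq_or_eq _ hA _ (snd_mem_verts ha) hws with h1 | h1
      · dsimp only at h1
        rw [h1] at hr' ⊢
        exact F.eventually_ray_left huv hr'
      · dsimp only at h1
        -- Here the side condition is used: prolongations at the common head go to `f ≥ 0`, away
        -- from the new edges.
        have h2 := hside a.1 (by rw [← h1]; exact ha)
        rw [h1] at hr' hws ⊢
        rcases h2.eq_or_lt with h2 | h2
        · exact F.eventually_ray_of_eq_zero huv hr' (by rw [map_smul, ← h2, smul_zero])
        · refine F.eventually_ray_of_pos huv hr' hws ?_
          rw [map_smul, smul_eq_mul]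
          positivity
    · exact F.eventually_ray_of_notMem huv hr' hws
  by_cases haA : a = (u, u + e)
  -- For `uv` itself the side must be the one opposite to `x`, so the frame that positioned `x` is
  -- kept.
  · subst haA
    refine key n g f c' m d (by simpa using F) hc' hray hside hm hmA ?_ hd ?_
    · filter_upwards [eventually_pos_smallParams] with p ⟨hp1, hp2⟩ hmp
      obtain ⟨-, -, -, -, -, h1⟩ := F.coord_of_mem_newEdges hp1 hp2 hmp
      rw [openSegment_eq_image'] at hm
      obtain ⟨s, hs, rfl⟩ := hm
      simp [F.f_e, F.g_e] at h1
      rcases h1 with h1 | h1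
      · exact hs.1.ne' h1
      · exact hs.2.ne h1
    · simp only [cover_stacked]
      exact F.eventually_ray_of_pos huv hmd (openSegment_subset_segment _ _ _ hm) hd
  · have hmuv := hmA' _ hA (Ne.symm haA)
    refine key n' g' f' c' m' d' F' hc' hray hs' hm' hmA' ?_ hd' ?_
    · filter_upwards [F.eventually_disjoint (K := {m'}) isCompact_singleton
        (by simpa using hmuv)] with p hp
      simpa using hp
    · simp only [cover_stacked]
      exact F.eventually_ray_of_notMem huv hmd' hmuv

lemma mem_verts_stacked (hA : (u, u + e) ∈ A) {p : ℝ × ℝ} {w : Plane} :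
    w ∈ verts (stacked A u e n p) ↔ w = stackPoint u e n p ∨ w ∈ verts A := by
  simp only [stacked, mem_verts_insert]
  constructor
  · rintro ((rfl | rfl) | (rfl | rfl) | h)
    · exact .inr (fst_mem_verts hA)
    · exact .inl rfl
    · exact .inr (snd_mem_verts hA)
    · exact .inl rfl
    · exact .inr h
  · rintro (rfl | h)
    · exact .inl (.inr rfl)
    · exact .inr (.inr h)

/-- A new vertex can be stacked on any edge of a good configuration. -/
theorem IsGood.exists_stack (h : IsGood A) {u v : Plane} (hA : (u, v) ∈ A) :
    ∃ x ∉ verts A, IsGood (insert (u, x) (insert (v, x) A)) := by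
  obtain ⟨e, rfl⟩ : ∃ e, v = u + e := ⟨v - u, by abel⟩
  obtain ⟨n, g, f, F, ⟨c, hc, hr⟩, hs, m, hm, hmA, d, hd, hmd⟩ := h.edge _ hA
  simp only [add_sub_cancel_left] at F hr
  have huv : segment ℝ u (u + e) ⊆ cover A := segment_subset_cover hA
  have hfin := finite_verts h.finite
  have hnotMem : ∀ w ∈ verts A, w ≠ u → w ≠ u + e → w ∉ segment ℝ u (u + e) := by
    intro w hw h1 h2 h3
    rcases h.eq_or_eq _ hA w hw h3 with h4 | h4
    exacts [h1 h4, h2 h4]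
  have h1 := F.eventually_escapes_near (isClosed_cover h.finite) huv hc hr
  have h2 : ∀ᶠ p in smallParams, stackPoint u e n p ∈ Metric.ball (0 : Plane) 2 :=
    eventually_stackPoint_mem Metric.isOpen_ball (by simpa using h.norm_lt _ (snd_mem_verts hA))
  have h3 : ∀ᶠ p in smallParams, ∀ w ∈ verts A, w ≠ u → w ≠ u + e →
      w ∉ newEdges u e n p.1 p.2 := by
    rw [Filter.eventually_all_finite hfin]
    intro w hw
    by_cases hne : w ≠ u ∧ w ≠ u + e
    · filter_upwards [F.eventually_disjoint (K := {w}) isCompact_singleton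
        (by simpa using hnotMem w hw hne.1 hne.2)] with p hp _ _
      simpa using hp
    · exact Eventually.of_forall fun p h1 h2 => absurd ⟨h1, h2⟩ hne
  have h4 : ∀ᶠ p in smallParams, ∀ w ∈ verts A, ∃ d, Ray (cover (stacked A u e n p)) w d := by
    rw [Filter.eventually_all_finite hfin]
    exact fun w hw => h.eventually_ray hA F hr hw
  have h5 : ∀ᶠ p in smallParams, ∀ v ∈ verts A, ∀ w ∈ verts A, v ≠ w → (v, w) ∉ A → (w, v) ∉ A →
      ∃ z ∈ segment ℝ v w, Escapes (cover (stacked A u e n p)) z := by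
    rw [Filter.eventually_all_finite hfin]
    intro v hv
    rw [Filter.eventually_all_finite hfin]
    intro w hw
    by_cases hvw : v ≠ w ∧ (v, w) ∉ A ∧ (w, v) ∉ A
    · obtain ⟨z, hz, hze⟩ := h.nonedge v hv w hw hvw.1 hvw.2.1 hvw.2.2
      filter_upwards [F.eventually_escapes huv hze] with p hp _ _ _
      rw [cover_stacked]
      exact ⟨z, hz, hp⟩
    · exact Eventually.of_forall fun p h1 h2 h3 => absurd ⟨h1, h2, h3⟩ hvw
  have h6 : ∀ᶠ p in smallParams, ∀ a ∈ A, IsGoodEdge (stacked A u e n p) a := by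
    rw [Filter.eventually_all_finite h.finite]
    exact fun a ha => h.eventually_isGoodEdge hA F hc hr hs hm hmA hd hmd ha
  have h7 : ∀ᶠ p in smallParams, ∀ w ∈ verts A, w ≠ u → w ≠ u + e →
      0 < p.2 * g (w - stackPoint u e n p) + p.1 * f (w - stackPoint u e n p) ∨
      0 < -(p.2 * g (w - stackPoint u e n p) + (1 + p.1) * f (w - stackPoint u e n p)) := by
    rw [Filter.eventually_all_finite hfin]
    intro w hw
    by_cases hne : w ≠ u ∧ w ≠ u + e
    · filter_upwards [F.eventually_sides (hnotMem w hw hne.1 hne.2)] with p hp _ _ using hp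
    · exact Eventually.of_forall fun p h1 h2 => absurd ⟨h1, h2⟩ hne
  -- Finitely many eventual conditions are now met by one common pair of parameters.
  have hne : smallParams.NeBot := by
    rw [smallParams, ← Filter.frequently_true_iff_neBot, Filter.frequently_curry_iff]
    exact (Eventually.of_forall fun _ => (Eventually.of_forall fun _ => trivial).frequently).frequently
  obtain ⟨p, ⟨hp1, hp2⟩, ⟨r, hr0, hball, hnear⟩, h2, h3, h4, h5, h6, h7⟩ :=
    (eventually_pos_smallParams.and (h1.and (h2.and (h3.and (h4.and (h5.and
      (h6.and h7))))))).exists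
  rw [← cover_stacked] at hnear
  change Metric.ball (stackPoint u e n p) r ⊆ _ at hball
  change ∀ z ∈ Metric.ball (stackPoint u e n p) r,
    (0 < (p.2 • g + p.1 • f) (z - stackPoint u e n p) ∨
      0 < (-(p.2 • g + (1 + p.1) • f)) (z - stackPoint u e n p)) → _ at hnear
  have hside₁ : (p.2 • g + p.1 • f) (stackPoint u e n p - u) = p.2 := by
    simp [stackPoint, F.g_e, F.g_n, F.f_e, F.f_n]; ring
  have hside₂ : (-(p.2 • g + (1 + p.1) • f)) (stackPoint u e n p - (u + e)) = p.2 := by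
    simp [stackPoint, F.g_e, F.g_n, F.f_e, F.f_n]; ring
  have hgx : g (stackPoint u e n p - u) = 1 + p.1 := by simp [stackPoint, F.g_e, F.g_n]
  have hfx : f (stackPoint u e n p - u) = -p.2 := by simp [stackPoint, F.f_e, F.f_n]
  set x := stackPoint u e n p with hx
  have hxA : x ∉ cover A := hball (Metric.mem_ball_self hr0)
  have hedgeL : IsGoodEdge (stacked A u e n p) (u, x) :=
    isGoodEdge_insert (F.stack_left hp1) (by rw [hside₂]; exact hp2) (by rw [hside₁]; exact hp2)
      hr0 hball fun z hz h => hnear z hz h.symm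
  have hedgeR : IsGoodEdge (stacked A u e n p) (u + e, x) := by
    rw [stacked, insert_comm]
    refine isGoodEdge_insert (F.stack_right hp1) (by rw [hside₁]; exact hp2)
      (by rw [hside₂]; exact hp2) hr0 hball fun z hz h => ?_
    rw [insert_comm]
    exact hnear z hz h
  -- A non-edge leaves `x` outside the sector, so its points close to `x` escape.
  have hnon : ∀ w ∈ verts A, (w, x) ∉ stacked A u e n p →
      ∃ z ∈ segment ℝ x w, Escapes (cover (stacked A u e n p)) z := by
    intro w hw hwx
    have hwu : w ≠ u := by rintro rfl; exact hwx (.inl rfl)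
    have hwv : w ≠ u + e := by rintro rfl; exact hwx (.inr (.inl rfl))
    obtain ⟨c, hc, hcb⟩ := exists_smul_ball (x := x) (d := w - x) hr0
    have hs0 : 0 < min c 1 := by positivity
    refine ⟨x + min c 1 • (w - x), ?_, hnear _ (hcb _ hs0.le (min_le_left _ _)) ?_⟩
    · rw [segment_eq_image']
      exact ⟨_, ⟨hs0.le, min_le_right _ _⟩, rfl⟩
    · rw [add_sub_cancel_left, map_smul, map_smul, smul_eq_mul, smul_eq_mul]
      exact (h7 w hw hwu hwv).imp (mul_pos hs0) (mul_pos hs0)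
  refine ⟨x, fun h => hxA (verts_subset_cover A h), ?_⟩
  change IsGood (stacked A u e n p)
  refine ⟨(h.finite.insert _).insert _, ⟨_, .inl rfl⟩, ?_, ?_, ?_, ?_, ?_⟩
  · intro w hw
    rcases (mem_verts_stacked hA).1 hw with rfl | hw
    · simpa using h2
    · exact h.norm_lt w hw
  · intro a ha w hw hwa
    rcases (mem_verts_stacked hA).1 hw with rfl | hw
    · rcases ha with rfl | rfl | ha
      · exact .inr rfl
      · exact .inr rfl
      · exact absurd (segment_subset_cover ha hwa) hxA
    · rcases ha with rfl | rfl | ha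
      · by_cases hwu : w = u
        · exact .inl hwu
        by_cases hwv : w = u + e
        · obtain ⟨s, -, -, hg, hf⟩ := F.eq_of_mem_segment_left (z := w) hwa
          subst hwv
          simp only [add_sub_cancel_left, F.g_e, F.f_e] at hg hf
          rcases mul_eq_zero.1 (neg_eq_zero.1 hf.symm) with h | h
          · simp [h] at hg
          · exact absurd h hp2.ne'
        · exact absurd (.inl hwa) (h3 w hw hwu hwv)
      · by_cases hwv : w = u + e
        · exact .inl hwv
        by_cases hwu : w = u
        · obtain ⟨s, hs0, -, hg, -⟩ := F.eq_of_mem_segment_right (z := w) hwa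
          subst hwu
          simp only [sub_self, map_zero] at hg
          nlinarith
        · exact absurd (.inr hwa) (h3 w hw hwu hwv)
      · exact h.eq_or_eq a ha w hw hwa
  · intro w hw
    rcases (mem_verts_stacked hA).1 hw with rfl | hw
    · obtain ⟨-, -, -, -, ⟨c, -, hc⟩, -⟩ := hedgeL
      exact ⟨_, hc⟩
    · exact h4 w hw
  · intro v hv w hw hvw h1 h2
    rcases (mem_verts_stacked hA).1 hv with rfl | hv
    · rcases (mem_verts_stacked hA).1 hw with rfl | hw
      · exact absurd rfl hvw
      · exact hnon w hw h2
    · rcases (mem_verts_stacked hA).1 hw with rfl | hw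
      · rw [segment_symm]
        exact hnon v hv h1
      · exact h5 v hv w hw hvw (fun h => h1 (.inr (.inr h))) (fun h => h2 (.inr (.inr h)))
  · rintro a (rfl | rfl | ha)
    · exact hedgeL
    · exact hedgeR
    · exact h6 a ha

end Stack

/-! ### From configurations to outside-obstacle representations -/

/-- From a point of norm at least two, the radial half-line outwards avoids the drawing and makes
the component unbounded. -/
lemma Escapes.mem_outerFace {V : Type u} {G : SimpleGraph V} {p : V → Plane}
    (hb : ∀ z ∈ drawingSet G p, ‖z‖ < 2) {z : Plane} (hz : Escapes (drawingSet G p) z) :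
    z ∈ outerFace G p := by
  refine ⟨hz.notMem, ?_⟩
  obtain ⟨K, -, hp, hD, hz, y, hyK, hy⟩ := hz
  have hray : IsPreconnected ((fun t : ℝ => t • y) '' Ici 1) :=
    isPreconnected_Ici.image _ (by fun_prop)
  have hconn : IsPreconnected (K ∪ (fun t : ℝ => t • y) '' Ici 1) :=
    IsPreconnected.union y hyK ⟨1, self_mem_Ici, one_smul _ _⟩ hp hray
  have hsub : K ∪ (fun t : ℝ => t • y) '' Ici 1 ⊆ (drawingSet G p)ᶜ := by
    refine union_subset hD ?_
    rintro _ ⟨t, ht, rfl⟩ hmem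
    have h1 : 1 ≤ t := ht
    have h2 := hb _ hmem
    rw [norm_smul, Real.norm_of_nonneg (by linarith)] at h2
    nlinarith
  intro hbdd
  obtain ⟨C, hC⟩ := (hbdd.subset
    (hconn.subset_connectedComponentIn (.inl hz) hsub)).exists_norm_le
  have h1 := hC _ (.inr ⟨|C| + 1, by simp, rfl⟩)
  rw [norm_smul, Real.norm_of_nonneg (by positivity)] at h1
  nlinarith [le_abs_self C, abs_nonneg C]

/-- A side of an edge is accessible along a whole subsegment around an accessible point. -/
lemma IsGood.exists_segment {A : Set (Plane × Plane)} (h : IsGood A) {a : Plane × Plane}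
    (ha : a ∈ A) : ∃ b c : Plane, b ≠ c ∧ segment ℝ b c ⊆ segment ℝ a.1 a.2 ∧
      ∀ z ∈ segment ℝ b c, ∃ d, Ray (cover A) z d := by
  obtain ⟨n, g, f, F, -, -, m, hm, hmA, d, hd, hmd⟩ := h.edge a ha
  obtain ⟨u, v⟩ := a
  dsimp only at *
  obtain ⟨e, rfl⟩ : ∃ e, v = u + e := ⟨v - u, by abel⟩
  rw [add_sub_cancel_left] at F
  have hcl : IsClosed (cover (A \ {(u, u + e)})) := isClosed_cover (h.finite.subset sdiff_subset)
  have hmcl : m ∈ (cover (A \ {(u, u + e)}))ᶜ := by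
    intro hmem
    obtain ⟨b, hb, hmb⟩ := mem_iUnion₂.1 hmem
    exact hmA b hb.1 hb.2 hmb
  obtain ⟨r, hr, hball⟩ := Metric.isOpen_iff.1 hcl.isOpen_compl m hmcl
  rw [openSegment_eq_image'] at hm
  obtain ⟨s, hs, rfl⟩ := hm
  rw [add_sub_cancel_left] at *
  set m := u + s • e with hm
  have hfm : ∀ z, f (z - u) = f (z - m) := by
    intro z
    have : z - u = (z - m) + s • e := by rw [hm]; abel
    rw [this, map_add, map_smul, F.f_e]; simp
  have hhalf : Metric.ball m r ∩ {z | 0 < f (z - u)} ⊆ (cover A)ᶜ := by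
    rintro z ⟨hz, hzf⟩ hzA
    obtain ⟨b, hb, hzb⟩ := mem_iUnion₂.1 hzA
    by_cases hba : b = (u, u + e)
    · subst hba
      exact hzf.ne' (F.mem_segment_iff'.1 hzb).2.2
    · exact hball hz (mem_iUnion₂.2 ⟨b, ⟨hb, hba⟩, hzb⟩)
  have hconv : Convex ℝ (Metric.ball m r ∩ {z | 0 < f (z - u)}) := by
    refine (convex_ball _ _).inter ?_
    simp only [map_sub, sub_pos]
    exact convex_halfSpace_gt f.toLinearMap.isLinear _
  obtain ⟨c₁, hc₁, hb₁⟩ := exists_smul_ball (x := m) (d := d) hr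
  have ht0 : 0 < min c₁ 1 := by positivity
  have hq := hmd (min c₁ 1) ht0 (min_le_right _ _)
  have hqB : m + min c₁ 1 • d ∈ Metric.ball m r ∩ {z | 0 < f (z - u)} := by
    refine ⟨hb₁ _ ht0.le (min_le_left _ _), ?_⟩
    rw [mem_ofPred_eq, hfm, add_sub_cancel_left, map_smul, smul_eq_mul]
    positivity
  have hesc : ∀ z ∈ Metric.ball m r, 0 < f (z - u) → Escapes (cover A) z :=
    fun z hz hzf => hq.of_convex hconv hhalf hqB ⟨hz, hzf⟩
  obtain ⟨c₂, hc₂, hb₂⟩ := exists_smul_ball (x := m) (d := e) hr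
  have hw0 : 0 < min c₂ (1 - s) := lt_min hc₂ (by linarith [hs.2])
  have he : e ≠ 0 := by
    rintro rfl
    simpa using F.g_e
  have hmem : ∀ z ∈ segment ℝ m (m + min c₂ (1 - s) • e), ∃ t : ℝ, 0 ≤ t ∧ t ≤ c₂ ∧ t ≤ 1 - s ∧
      z = m + t • e := by
    intro z hz
    rw [segment_eq_image'] at hz
    obtain ⟨t, ht, rfl⟩ := hz
    have h1 := min_le_left c₂ (1 - s)
    have h2 := min_le_right c₂ (1 - s)
    refine ⟨t * min c₂ (1 - s), mul_nonneg ht.1 hw0.le, ?_, ?_, by simp [smul_smul]⟩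
    · nlinarith [ht.2]
    · nlinarith [ht.2]
  refine ⟨m, m + min c₂ (1 - s) • e, ?_, ?_, ?_⟩
  · simp [hw0.ne', he]
  · intro z hz
    obtain ⟨t, h0, -, h1, rfl⟩ := hmem z hz
    rw [segment_eq_image']
    exact ⟨s + t, ⟨by linarith [hs.1], by linarith⟩, by simp [hm, add_smul, add_assoc]⟩
  · intro z hz
    obtain ⟨t, h0, h1, -, rfl⟩ := hmem z hz
    obtain ⟨r', hr', hrB⟩ := Metric.isOpen_iff.1 Metric.isOpen_ball _ (hb₂ t h0 h1)
    obtain ⟨c₃, hc₃, hb₃⟩ := exists_smul_ball (x := m + t • e) (d := n) hr'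
    refine ⟨c₃ • n, fun a ha0 ha1 => ?_⟩
    rw [smul_smul]
    refine hesc _ (hrB (hb₃ _ (by positivity) (by nlinarith))) ?_
    have : m + t • e + (a * c₃) • n - m = t • e + (a * c₃) • n := by abel
    rw [hfm, this, map_add, map_smul, map_smul, F.f_e, F.f_n]
    simp only [smul_eq_mul, mul_zero, zero_add, mul_one]
    positivity

/-- Every graph that embeds into a good configuration admits a reducible outside-obstacle
representation with all vertices on the outer face. -/
theorem IsGood.admits {A : Set (Plane × Plane)} (h : IsGood A) {V : Type u} {G : SimpleGraph V}
    {p : V → Plane} (hp : Function.Injective p) (hpA : ∀ v, p v ∈ verts A)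
    (hadj : ∀ v w, G.Adj v w → (p v, p w) ∈ A ∨ (p w, p v) ∈ A) :
    AdmitsReducibleOORWithVerticesOnOuterFace G := by
  have hseg : ∀ v w, G.Adj v w → ∃ a ∈ A, (a = (p v, p w) ∨ a = (p w, p v)) ∧
      segment ℝ (p v) (p w) = segment ℝ a.1 a.2 := by
    intro v w hvw
    rcases hadj v w hvw with h | h
    · exact ⟨_, h, .inl rfl, rfl⟩
    · exact ⟨_, h, .inr rfl, segment_symm ..⟩
  have hdraw : drawingSet G p ⊆ cover A := by
    refine union_subset ?_ (iUnion_subset fun v => iUnion_subset fun w => iUnion_subset fun hvw => ?_)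
    · rintro _ ⟨v, rfl⟩
      exact verts_subset_cover A (hpA v)
    · obtain ⟨a, ha, -, h⟩ := hseg v w hvw
      rw [h]
      exact segment_subset_cover ha
  have hcov : ∀ z ∈ cover A, ‖z‖ < 2 := by
    intro z hz
    obtain ⟨a, ha, hza⟩ := mem_iUnion₂.1 hz
    have := (convex_ball (0 : Plane) 2).segment_subset
      (by simpa using h.norm_lt _ (fst_mem_verts ha))
      (by simpa using h.norm_lt _ (snd_mem_verts ha)) hza
    simpa using this
  have hesc : ∀ z, Escapes (drawingSet G p) z → z ∈ outerFace G p :=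
    fun z hz => hz.mem_outerFace fun w hw => hcov w (hdraw hw)
  have hfront : ∀ z ∈ drawingSet G p, ∀ d, Ray (cover A) z d → z ∈ frontier (outerFace G p) :=
    fun z hz d hd => ⟨(hd.anti hdraw).mem_closure hesc, fun hz' => (interior_subset hz').1 hz⟩
  have hsub : ∀ v w, G.Adj v w → segment ℝ (p v) (p w) ⊆ drawingSet G p := by
    intro v w hvw z hz
    exact .inr (mem_iUnion₂.2 ⟨v, w, mem_iUnion.2 ⟨hvw, hz⟩⟩)
  -- An edge of `A` absent from `G` is open at its point `m`, which lies on no other edge: the ray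
  -- at `m` now includes its starting point.
  have hmiss : ∀ v w, v ≠ w → ¬ G.Adj v w → (p v, p w) ∈ A →
      ∃ z ∈ segment ℝ (p v) (p w), z ∈ outerFace G p := by
    intro v w hvw hn hA
    obtain ⟨-, -, -, -, -, -, m, hm, hmA, d, -, hmd⟩ := h.edge _ hA
    refine ⟨m, openSegment_subset_segment _ _ _ hm, hesc m ?_⟩
    have hne : p v ≠ p w := hp.ne hvw
    have hmD : m ∉ drawingSet G p := by
      rintro (⟨x, rfl⟩ | hmem)
      · rcases h.eq_or_eq _ hA _ (hpA x) (openSegment_subset_segment _ _ _ hm) with h1 | h1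
        · rw [h1, left_mem_openSegment_iff] at hm
          exact hne hm
        · rw [h1, right_mem_openSegment_iff] at hm
          exact hne hm
      · obtain ⟨x, y, hmem⟩ := mem_iUnion₂.1 hmem
        obtain ⟨hxy, hmem⟩ := mem_iUnion.1 hmem
        obtain ⟨a, ha, ha', hs⟩ := hseg x y hxy
        rw [hs] at hmem
        refine hmA a ha ?_ hmem
        rintro rfl
        rcases ha' with h1 | h1
        · obtain ⟨h2, h3⟩ := Prod.ext_iff.1 h1
          rw [hp h2, hp h3] at hn
          exact hn hxy
        · obtain ⟨h2, h3⟩ := Prod.ext_iff.1 h1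
          rw [hp h2, hp h3] at hn
          exact hn hxy.symm
    have h1 : Escapes (drawingSet G p) (m + d) := by
      simpa using (hmd.anti hdraw) 1 one_pos le_rfl
    refine h1.of_segment ?_
    rw [segment_eq_image']
    rintro _ ⟨t, ht, rfl⟩
    rw [add_sub_cancel_left]
    rcases ht.1.eq_or_lt with rfl | ht0
    · simpa using hmD
    · exact ((hmd.anti hdraw) t ht0 ht.2).notMem
  refine ⟨p, ⟨⟨⟨hp, ?_⟩, ?_⟩, ?_⟩, ?_⟩
  · intro v w x hvw hx
    obtain ⟨a, ha, ha', hs⟩ := hseg v w hvw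
    rw [hs] at hx
    have h1 := h.eq_or_eq a ha _ (hpA x) hx
    rcases ha' with rfl | rfl
    · exact h1.imp (fun h => hp h) (fun h => hp h)
    · exact h1.symm.imp (fun h => hp h) (fun h => hp h)
  · intro v w hvw
    constructor
    · intro hadj
      exact Set.disjoint_left.2 fun z hz hz' => hz'.1 (hsub v w hadj hz)
    · intro hd
      by_contra hn
      obtain ⟨z, hz, hz'⟩ : ∃ z ∈ segment ℝ (p v) (p w), z ∈ outerFace G p := by
        by_cases h1 : (p v, p w) ∈ A
        · exact hmiss v w hvw hn h1
        by_cases h2 : (p w, p v) ∈ A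
        · rw [segment_symm]
          exact hmiss w v hvw.symm (fun h => hn h.symm) h2
        obtain ⟨z, hz, hze⟩ := h.nonedge _ (hpA v) _ (hpA w) (hp.ne hvw) h1 h2
        exact ⟨z, hz, hesc z (hze.anti hdraw)⟩
      exact Set.disjoint_left.1 hd hz hz'
  · intro v w hvw
    obtain ⟨a, ha, -, hs⟩ := hseg v w hvw
    obtain ⟨b, c, hbc, hsub', hray⟩ := h.exists_segment ha
    rw [← hs] at hsub'
    refine ⟨b, c, hbc, hsub', fun z hz => ?_⟩
    obtain ⟨d, hd⟩ := hray z hz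
    exact hfront z (hsub v w hvw (hsub' hz)) d hd
  · intro v
    obtain ⟨d, hd⟩ := h.ray _ (hpA v)
    exact hfront _ (.inl ⟨v, rfl⟩) d hd

/-- A single edge is a good configuration. -/
theorem exists_isGood : ∃ A, IsGood A := by
  set e : Plane := EuclideanSpace.single 0 1 with he
  set n : Plane := EuclideanSpace.single 1 1 with hn
  obtain ⟨g, f, F⟩ : ∃ g f, Frame e n g f := by
    refine ⟨EuclideanSpace.proj 0, EuclideanSpace.proj 1, ?_, ?_, ?_, ?_, fun z => ?_⟩
    · simp [he]
    · simp [he]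
    · simp [hn]
    · simp [hn]
    · ext i
      fin_cases i <;> simp [he, hn]
  have hcover : cover {((0 : Plane), e)} = segment ℝ 0 e := by simp [cover]
  have hmem : ∀ z, z ∈ cover {((0 : Plane), e)} → 0 ≤ g z ∧ g z ≤ 1 ∧ f z = 0 := by
    intro z hz
    rw [hcover] at hz
    simpa using (F.mem_segment_iff' (u := 0) (z := z)).1 (by simpa using hz)
  have hverts : ∀ w ∈ verts {((0 : Plane), e)}, w = 0 ∨ w = e := by
    rintro w ⟨a, rfl, h⟩
    exact h
  have he0 : e ≠ 0 := by simp [he]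
  have hn0 : n ≠ 0 := by simp [hn]
  have hray0 : Ray (cover {((0 : Plane), e)}) 0 (-e) := by
    intro t h0 h1
    refine escapes_of_forall_add_smul (neg_ne_zero.2 he0) fun s hs hz => ?_
    have := (hmem _ hz).1
    simp [F.g_e] at this
    linarith
  have hray1 : Ray (cover {((0 : Plane), e)}) e e := by
    intro t h0 h1
    refine escapes_of_forall_add_smul he0 fun s hs hz => ?_
    have := (hmem _ hz).2.1
    simp [F.g_e] at this
    linarith
  refine ⟨{(0, e)}, finite_singleton _, singleton_nonempty _, ?_, ?_, ?_, ?_, ?_⟩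
  · intro w hw
    rcases hverts w hw with rfl | rfl <;> simp [he]
  · rintro a rfl w hw -
    exact hverts w hw
  · intro w hw
    rcases hverts w hw with rfl | rfl
    exacts [⟨_, hray0⟩, ⟨_, hray1⟩]
  · intro v hv w hw hvw h1 h2
    rcases hverts v hv with rfl | rfl <;> rcases hverts w hw with rfl | rfl <;> simp at *
  · rintro a rfl
    refine ⟨n, g, f, by simpa using F, ⟨1, one_pos, by simpa using hray1⟩, ?_,
      (1 / 2 : ℝ) • e, ?_, ?_, n, by simp [F.f_n], ?_⟩
    · rintro w hw
      obtain rfl : w = 0 := (Prod.ext_iff.1 hw).1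
      simp [F.f_e]
    · rw [openSegment_eq_image']
      exact ⟨1 / 2, by norm_num, by simp⟩
    · rintro b rfl hb
      exact absurd rfl hb
    · intro t h0 h1
      refine escapes_of_forall_add_smul hn0 fun s hs hz => ?_
      have := (hmem _ hz).2.2
      simp [F.f_e, F.f_n] at this
      linarith

/-! ### Placing 2-trees and graphs of treewidth two -/

/-- The points `v` and `w` are joined by an edge of `A`, in one of the two orientations. -/
def Joined (A : Set (Plane × Plane)) (v w : Plane) : Prop := (v, w) ∈ A ∨ (w, v) ∈ A

lemma Joined.mono {A A' : Set (Plane × Plane)} (hA : A ⊆ A') {v w : Plane} (h : Joined A v w) :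
    Joined A' v w :=
  h.imp (fun h => hA h) (fun h => hA h)

lemma Joined.symm {A : Set (Plane × Plane)} {v w : Plane} (h : Joined A v w) : Joined A w v :=
  Or.symm h

lemma verts_mono {A A' : Set (Plane × Plane)} (hA : A ⊆ A') : verts A ⊆ verts A' :=
  fun _ ⟨a, ha, h⟩ => ⟨a, hA ha, h⟩

/-- The elements of `X` are placed at distinct vertices of a good configuration. -/
structure IsPlacement {V : Type u} (A : Set (Plane × Plane)) (p : V → Plane) (X : Set V) :
    Prop where
  good : IsGood A
  injOn : InjOn p X
  mapsTo : MapsTo p X (verts A)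

/-- The elements of `B` are placed at pairwise joined points. -/
def IsJoinedOn {V : Type u} (A : Set (Plane × Plane)) (p : V → Plane) (B : Set V) : Prop :=
  ∀ v ∈ B, ∀ w ∈ B, v ≠ w → Joined A (p v) (p w)

lemma IsJoinedOn.congr {V : Type u} {A A' : Set (Plane × Plane)} {p p' : V → Plane} {B X : Set V}
    (h : IsJoinedOn A p B) (hA : A ⊆ A') (hp : EqOn p' p X) (hB : B ⊆ X) :
    IsJoinedOn A' p' B := by
  intro v hv w hw hvw
  rw [hp (hB hv), hp (hB hw)]
  exact (h v hv w hw hvw).mono hA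

/-- At most two pairwise joined vertices lie on a common edge of `A`, and the new vertex is stacked
there. With fewer than two, the remaining endpoints may be auxiliary. -/
lemma IsPlacement.exists_insert {V : Type u} {A : Set (Plane × Plane)} {p : V → Plane} {X : Set V}
    (h : IsPlacement A p X) {w : V} (hw : w ∉ X) {B : Finset V} (hB : (B : Set V) ⊆ X)
    (hcard : B.card ≤ 2) (hJ : IsJoinedOn A p B) :
    ∃ A' p', A ⊆ A' ∧ EqOn p' p X ∧ IsPlacement A' p' (insert w X) ∧
      ∀ v ∈ B, Joined A' (p' v) (p' w) := by
  classical
  obtain ⟨a, ha, haB⟩ : ∃ a ∈ A, ∀ b ∈ B, p b = a.1 ∨ p b = a.2 := by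
    obtain h0 | h1 | h2 : B.card = 0 ∨ B.card = 1 ∨ B.card = 2 := by omega
    · obtain ⟨a, ha⟩ := h.good.nonempty
      rw [Finset.card_eq_zero] at h0
      exact ⟨a, ha, by simp [h0]⟩
    · obtain ⟨b, rfl⟩ := Finset.card_eq_one.1 h1
      obtain ⟨a, ha, hab⟩ := h.mapsTo (hB (by simp : b ∈ ((({b} : Finset V)) : Set V)))
      exact ⟨a, ha, by simpa using hab⟩
    · obtain ⟨b, c, hbc, rfl⟩ := Finset.card_eq_two.1 h2
      rcases hJ b (by simp) c (by simp) hbc with h3 | h3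
      · exact ⟨_, h3, by simp⟩
      · exact ⟨_, h3, by simp⟩
  obtain ⟨x, hx, hgood⟩ := h.good.exists_stack (u := a.1) (v := a.2) ha
  have hsub : A ⊆ insert (a.1, x) (insert (a.2, x) A) :=
    (subset_insert _ _).trans (subset_insert _ _)
  have heq : EqOn (Function.update p w x) p X := by
    intro v hv
    exact Function.update_of_ne (by rintro rfl; exact hw hv) _ _
  refine ⟨_, Function.update p w x, hsub, heq, ⟨hgood, ?_, ?_⟩, ?_⟩
  · rw [injOn_insert hw, heq.injOn_iff, heq.image_eq, Function.update_self]
    refine ⟨h.injOn, ?_⟩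
    rintro ⟨v, hv, rfl⟩
    exact hx (h.mapsTo hv)
  · rintro v (rfl | hv)
    · rw [Function.update_self]
      exact snd_mem_verts (mem_insert _ _)
    · rw [heq hv]
      exact verts_mono hsub (h.mapsTo hv)
  · intro v hv
    rw [heq (hB hv), Function.update_self]
    rcases haB v hv with h1 | h1 <;> rw [h1]
    · exact .inl (.inl rfl)
    · exact .inl (.inr (.inl rfl))

lemma IsPlacement.exists_union {V : Type u} [DecidableEq V] {A : Set (Plane × Plane)}
    {p : V → Plane} {X : Set V} (h : IsPlacement A p X) {B : Finset V} (hB : (B : Set V) ⊆ X)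
    (hJ : IsJoinedOn A p B) (C : Finset V) (hC : ∀ c ∈ C, c ∉ X) (hcard : (B ∪ C).card ≤ 3) :
    ∃ A' p', A ⊆ A' ∧ EqOn p' p X ∧ IsPlacement A' p' (X ∪ C) ∧
      IsJoinedOn A' p' ((B ∪ C : Finset V) : Set V) := by
  induction C using Finset.induction_on with
  | empty => exact ⟨A, p, Subset.rfl, fun _ _ => rfl, by simpa using h, by simpa using hJ⟩
  | insert w C hwC ih =>
    have hwX : w ∉ X := hC w (Finset.mem_insert_self _ _)
    have hw : w ∉ B ∪ C := by
      rw [Finset.mem_union, not_or]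
      exact ⟨fun hw => hwX (hB hw), hwC⟩
    rw [Finset.union_insert, Finset.card_insert_of_notMem hw] at hcard
    obtain ⟨A₁, p₁, hA₁, hp₁, hpl, hJ₁⟩ :=
      ih (fun c hc => hC c (Finset.mem_insert_of_mem hc)) (by omega)
    have hsub : ((B ∪ C : Finset V) : Set V) ⊆ X ∪ C := by
      rw [Finset.coe_union]
      exact union_subset_union_left _ hB
    obtain ⟨A₂, p₂, hA₂, hp₂, hpl₂, hJ₂⟩ := hpl.exists_insert (w := w) (by simp [hwX, hwC]) hsub
      (by omega) hJ₁
    refine ⟨A₂, p₂, hA₁.trans hA₂, (hp₂.mono subset_union_left).trans hp₁, ?_, ?_⟩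
    · simpa [union_insert] using hpl₂
    · have hJ₃ := hJ₁.congr hA₂ hp₂ hsub
      rw [Finset.union_insert, Finset.coe_insert]
      rintro v (rfl | hv) v' (rfl | hv') hne
      · exact absurd rfl hne
      · exact (hJ₂ v' hv').symm
      · exact hJ₂ v hv
      · exact hJ₃ v hv v' hv' hne

/-- The graph `G` is placed on a subgraph of a good configuration. -/
def HasPlacement {V : Type u} (G : SimpleGraph V) : Prop :=
  ∃ A p, IsPlacement A p (univ : Set V) ∧ ∀ v w, G.Adj v w → Joined A (p v) (p w)

lemma HasPlacement.admits {V : Type u} {G : SimpleGraph V} (h : HasPlacement G) :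
    AdmitsReducibleOORWithVerticesOnOuterFace G := by
  obtain ⟨A, p, hp, hG⟩ := h
  exact hp.good.admits (injOn_univ.1 hp.injOn) (fun v => hp.mapsTo (mem_univ v)) hG

lemma HasPlacement.of_isContained {V W : Type u} {G : SimpleGraph V} {T : SimpleGraph W}
    (h : HasPlacement T) (hGT : G.IsContained T) : HasPlacement G := by
  obtain ⟨A, p, hp, hT⟩ := h
  obtain ⟨c⟩ := hGT
  refine ⟨A, p ∘ c.toHom, ⟨hp.good, ?_, fun v _ => hp.mapsTo (mem_univ _)⟩, fun v w hvw =>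
    hT _ _ (c.toHom.map_adj hvw)⟩
  exact ((injOn_univ.1 hp.injOn).comp c.injective).injOn

/-- The endpoints of the initial edge remain auxiliary, so every vertex of the graph arises by
stacking. -/
lemma exists_isPlacement_empty (V : Type u) :
    ∃ A, IsPlacement A (fun _ : V => (0 : Plane)) ∅ := by
  obtain ⟨A, hA⟩ := exists_isGood
  exact ⟨A, hA, injOn_empty _, mapsTo_empty _ _⟩

theorem IsTwoTree.hasPlacement {V : Type u} {G : SimpleGraph V} (h : IsTwoTree G) :
    HasPlacement G := by
  classical
  induction h with
  | @triangle V G e =>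
    have : Fintype V := Fintype.ofEquiv _ e.toEquiv.symm
    obtain ⟨A, hA⟩ := exists_isPlacement_empty V
    have hcard : Fintype.card V = 3 := by simpa using Fintype.card_congr e.toEquiv
    obtain ⟨A', p', -, -, hp, hJ⟩ := hA.exists_union (B := ∅) (by simp) (by simp [IsJoinedOn])
      Finset.univ (by simp) (by simp [hcard])
    refine ⟨A', p', by simpa using hp, fun v w hvw => hJ v (by simp) w (by simp) hvw.ne⟩
  | @stack V G x a b hab hx hG ih =>
    obtain ⟨A, p, hp, hT⟩ := ih
    -- The value at `x` is a dummy, replaced when `x` is stacked.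
    set q : V → Plane := fun v => if h : v ∈ ({x}ᶜ : Set V) then p ⟨v, h⟩ else 0 with hq
    have hqp : ∀ v (h : v ∈ ({x}ᶜ : Set V)), q v = p ⟨v, h⟩ := fun v h => by simp only [hq, dif_pos h]
    have hpl : IsPlacement A q {x}ᶜ := by
      refine ⟨hp.good, fun v hv w hw hvw => ?_, fun v hv => ?_⟩
      · rw [hqp v hv, hqp w hw] at hvw
        exact congrArg Subtype.val (hp.injOn (mem_univ _) (mem_univ _) hvw)
      · rw [hqp v hv]
        exact hp.mapsTo (mem_univ _)
    have hadj : ∀ v w, v ≠ x → w ≠ x → G.Adj v w → Joined A (q v) (q w) := by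
      intro v w hv hw hvw
      rw [hqp v hv, hqp w hw]
      exact hT _ _ hvw
    have hax : a ≠ x := by
      rintro rfl
      exact G.loopless.irrefl a ((G.mem_neighborSet a a).1 (by simp [hx]))
    have hbx : b ≠ x := by
      rintro rfl
      exact G.loopless.irrefl b ((G.mem_neighborSet b b).1 (by simp [hx]))
    have hJ : IsJoinedOn A q (({a, b} : Finset V) : Set V) := by
      have h1 := hadj a b hax hbx hab
      intro v hv w hw hvw
      simp only [Finset.coe_insert, Finset.coe_singleton, mem_insert_iff, mem_singleton_iff]
        at hv hw
      rcases hv with rfl | rfl <;> rcases hw with rfl | rfl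
      exacts [absurd rfl hvw, h1, h1.symm, absurd rfl hvw]
    obtain ⟨A', p', hA', hp', hpl', hJ'⟩ := hpl.exists_insert (w := x) (by simp)
      (by simp [hax.symm, hbx.symm]) Finset.card_le_two hJ
    have hnb : ∀ v, G.Adj x v → Joined A' (p' v) (p' x) := by
      intro v hv
      have : v ∈ G.neighborSet x := hv
      rw [hx] at this
      exact hJ' v (by simpa using this)
    refine ⟨A', p', ?_, fun v w hvw => ?_⟩
    · rwa [insert_eq, union_compl_self] at hpl'
    · by_cases hvx : v = x
      · subst hvx
        exact (hnb w hvw).symm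
      by_cases hwx : w = x
      · subst hwx
        exact hnb v hvw.symm
      rw [hp' hvx, hp' hwx]
      exact (hadj v w hvx hwx hvw).mono hA'

/-- In a tree decomposition, a node `i` adjacent to a node `j` of a connected set `J` of nodes
shares with the nodes of `J` only elements of the bag of `j`. -/
lemma TreeDecomposition.mem_bag_of_adj {V : Type u} {G : SimpleGraph V} {I : Type}
    (D : TreeDecomposition G I) {J : Set I} {i j k : I} (hij : D.tree.Adj i j) (hi : i ∉ J)
    (hJ : ∃ q : D.tree.Walk j k, ∀ l ∈ q.support, l ∈ J) {v : V} (hvi : v ∈ D.bag i)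
    (hvk : v ∈ D.bag k) : v ∈ D.bag j := by
  classical
  obtain ⟨q, hq⟩ := hJ
  obtain ⟨w⟩ := (D.bags_connected v).preconnected ⟨i, hvi⟩ ⟨k, hvk⟩
  obtain ⟨w', hw'⟩ : ∃ w' : D.tree.Walk i k, ∀ l ∈ w'.support, v ∈ D.bag l := by
    refine ⟨w.map (SimpleGraph.Embedding.induce {i | v ∈ D.bag i}).toHom, fun l hl => ?_⟩
    obtain ⟨l', -, rfl⟩ := List.mem_map.1 ((SimpleGraph.Walk.support_map _ w) ▸ hl)
    exact l'.2
  have hpath : (SimpleGraph.Walk.cons hij q.bypass).IsPath := by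
    rw [SimpleGraph.Walk.cons_isPath_iff]
    exact ⟨q.bypass_isPath, fun h => hi (hq i (q.support_bypass_subset_support h))⟩
  -- Paths in a tree are unique, so the path from `i` to `k` within the bags containing `v` passes
  -- through `j`.
  have huniq : SimpleGraph.Walk.cons hij q.bypass = w'.bypass :=
    congrArg Subtype.val ((D.isTree.isAcyclic.subsingleton_path i k).elim ⟨_, hpath⟩
      ⟨_, w'.bypass_isPath⟩)
  refine hw' j (w'.support_bypass_subset_support ?_)
  rw [← huniq]
  simp

/-- A connected set of tree nodes is enlarged by one neighbour at a time, keeping each treated bag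
pairwise joined. The placed part of a new bag lies in the bag of that neighbour, hence is already
joined; as bags have at most three elements, the others can be stacked in turn. -/
theorem TreewidthAtMost.hasPlacement {V : Type u} {G : SimpleGraph V} (h : TreewidthAtMost G 2) :
    HasPlacement G := by
  classical
  obtain ⟨I, hI, D, hD⟩ := h
  have := Fintype.ofFinite I
  have key : ∀ k ≤ Fintype.card I, ∃ J : Finset I, J.card = k ∧
      (∀ j ∈ J, ∀ l ∈ J, ∃ q : D.tree.Walk j l, ∀ m ∈ q.support, m ∈ (J : Set I)) ∧
      ∃ A p, IsPlacement A p {v | ∃ j ∈ J, v ∈ D.bag j} ∧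
        ∀ j ∈ J, IsJoinedOn A p (D.bag j : Set V) := by
    intro k
    induction k with
    | zero =>
      obtain ⟨A, hA⟩ := exists_isPlacement_empty V
      exact fun _ => ⟨∅, rfl, by simp, A, _, by simpa using hA, by simp⟩
    | succ k ih =>
      intro hk
      obtain ⟨J, hJk, hJ, A, p, hp, hb⟩ := ih (by omega)
      obtain ⟨i, hi, hi'⟩ : ∃ i ∉ J, J = ∅ ∨ ∃ j ∈ J, D.tree.Adj i j := by
        obtain ⟨i₀, hi₀⟩ : ∃ i, i ∉ J := by
          by_contra! hcon
          rw [Finset.eq_univ_iff_forall.2 hcon, Finset.card_univ] at hJk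
          omega
        rcases J.eq_empty_or_nonempty with h0 | ⟨j₀, hj₀⟩
        · exact ⟨i₀, hi₀, .inl h0⟩
        · obtain ⟨w⟩ := D.isTree.connected.preconnected j₀ i₀
          obtain ⟨d, -, h1, h2⟩ := w.exists_boundary_dart (J : Set I) hj₀ hi₀
          exact ⟨d.snd, h2, .inr ⟨d.fst, h1, d.adj.symm⟩⟩
      set X : Set V := {v | ∃ j ∈ J, v ∈ D.bag j} with hX
      obtain ⟨B, hBi, hBX, hBJ, hiB⟩ : ∃ B ⊆ D.bag i, (B : Set V) ⊆ X ∧ IsJoinedOn A p (B : Set V) ∧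
          ∀ v ∈ D.bag i, v ∈ X → v ∈ B := by
        rcases hi' with rfl | ⟨j, hj, hij⟩
        · exact ⟨∅, by simp, by simp, by simp [IsJoinedOn], by simp [hX]⟩
        · refine ⟨D.bag i ∩ D.bag j, Finset.inter_subset_left, fun v hv => ?_, ?_, ?_⟩
          · exact ⟨j, hj, (Finset.mem_inter.1 hv).2⟩
          · intro v hv w hw
            exact hb j hj v (Finset.mem_inter.1 hv).2 w (Finset.mem_inter.1 hw).2
          · rintro v hv ⟨l, hl, hvl⟩
            exact Finset.mem_inter.2 ⟨hv, D.mem_bag_of_adj (J := J) hij hi (hJ j hj l hl) hv hvl⟩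
      set C := (D.bag i).filter (· ∉ X) with hC
      have hBC : B ∪ C = D.bag i := by
        ext v
        by_cases hvX : v ∈ X
        · simp only [hC, Finset.mem_union, Finset.mem_filter, hvX, not_true, and_false, or_false]
          exact ⟨fun h => hBi h, fun h => hiB v h hvX⟩
        · simp only [hC, Finset.mem_union, Finset.mem_filter, hvX, not_false_iff, and_true]
          exact ⟨fun h => h.elim (fun h => hBi h) id, .inr⟩
      obtain ⟨A', p', hA', hp', hpl, hJ'⟩ := hp.exists_union hBX hBJ C
        (fun c hc => (Finset.mem_filter.1 hc).2) (by rw [hBC]; exact hD i)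
      rw [hBC] at hJ'
      refine ⟨insert i J, by rw [Finset.card_insert_of_notMem hi, hJk], ?_, A', p', ?_, ?_⟩
      · have hnew : ∀ l ∈ J, ∃ q : D.tree.Walk i l,
            ∀ m ∈ q.support, m ∈ ((insert i J : Finset I) : Set I) := by
          intro l hl
          rcases hi' with rfl | ⟨j, hj, hij⟩
          · simp at hl
          · obtain ⟨q, hq⟩ := hJ j hj l hl
            refine ⟨SimpleGraph.Walk.cons hij q, fun m hm => ?_⟩
            rw [SimpleGraph.Walk.support_cons, List.mem_cons] at hm
            rcases hm with rfl | hm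
            · simp
            · exact Finset.mem_insert_of_mem (hq m hm)
        intro j hj l hl
        rw [Finset.mem_insert] at hj hl
        rcases hj with hj | hj
        · subst hj
          rcases hl with hl | hl
          · subst hl
            exact ⟨SimpleGraph.Walk.nil, by simp⟩
          · exact hnew l hl
        · rcases hl with hl | hl
          · subst hl
            obtain ⟨q, hq⟩ := hnew j hj
            exact ⟨q.reverse, fun m hm => hq m (by simpa using hm)⟩
          · obtain ⟨q, hq⟩ := hJ j hj l hl
            exact ⟨q, fun m hm => Finset.mem_insert_of_mem (hq m hm)⟩
      · convert hpl using 1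
        ext v
        have hvC : v ∈ C ↔ v ∈ D.bag i ∧ v ∉ X := by simp [hC]
        have hvX : v ∈ X ↔ ∃ j ∈ J, v ∈ D.bag j := Iff.rfl
        simp only [Finset.mem_insert, exists_eq_or_imp, mem_union, Finset.mem_coe, hvC, ← hvX,
          mem_ofPred_eq]
        tauto
      · intro j hj
        rcases Finset.mem_insert.1 hj with rfl | hj
        · exact hJ'
        · exact (hb j hj).congr hA' hp' fun v hv => ⟨j, hj, hv⟩
  obtain ⟨J, hJ, -, A, p, hp, hb⟩ := key _ le_rfl
  obtain rfl : J = Finset.univ := (Finset.card_eq_iff_eq_univ J).1 hJ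
  refine ⟨A, p, ?_, fun v w hvw => ?_⟩
  · convert hp using 1
    exact (Set.eq_univ_of_forall fun v => by
      obtain ⟨i, hi⟩ := D.vertex_mem_bag v
      exact ⟨i, Finset.mem_univ i, hi⟩).symm
  · obtain ⟨i, hv, hw⟩ := D.edge_mem_bag v w hvw
    exact hb i (Finset.mem_univ i) v hv w hw hvw.ne

end OutsideObstacle

theorem mainTheorem1 {V : Type*} [Finite V] (G : SimpleGraph V) :
    (OutsideObstacle.IsTwoTree G →
      OutsideObstacle.AdmitsReducibleOORWithVerticesOnOuterFace G) ∧
    (OutsideObstacle.IsPartialTwoTree G →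
      OutsideObstacle.AdmitsReducibleOORWithVerticesOnOuterFace G) ∧
    (OutsideObstacle.TreewidthAtMost G 2 →
      OutsideObstacle.AdmitsReducibleOORWithVerticesOnOuterFace G) := by
  refine ⟨fun h => h.hasPlacement.admits, ?_, fun h => h.hasPlacement.admits⟩
  rintro ⟨W, T, hT, hGT⟩
  exact (hT.hasPlacement.of_isContained hGT).admits
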